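/- Let $\mathfrak C=\{0,1\}^{\mathbb N}$ be the Cantor set, and let $V$ be Thompson's group: the group of homeomorphisms of $\mathfrak C$ that are locally of the form $uw\mapsto vw$ with $u,v$ finite binary words. A \emph{strand diagram} (with one source and one sink) is a finite acyclic digraph whose vertices are a source with one outgoing edge, a sink with one incoming edge, \emph{splits} (one incoming edge, a left and a right outgoing edge) and \emph{merges} (a left and a right incoming edge, one outgoing edge). Splits and merges are called carets. An infinite binary word put on the source edge travels down: at a split it loses its first letter and goes left if this letter is $0$, right if it is $1$; at a merge it gets the new first letter $0$ if it arrives from the left, $1$ if it arrives from the right. The diagram \emph{represents} $g\in V$ if every $w\in\mathfrak C$ put on the source edge arrives at the sink as $g(w)$. (For example, every pair of finite binary trees with $n$ leaves and a bijection between their leaves gives such a diagram.) Writing the diagram \emph{on a cylinder} means gluing the sink to the source and forgetting the resulting bivalent vertex; the edge through this point (crossing the seam) gets the label $1$ and all other edges get the label $0$. In such a labelled diagram there may be edges without endpoints, called \emph{circles}. A \emph{merge-split pair} is an edge $y$ from a merge to a split. The \emph{labelled Rule I} removes such a merge and split together with the edge $y$ and joins the left (resp. right) incoming edge of the merge to the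 left (resp. right) outgoing edge of the split; the label of each edge obtained is the sum of the labels of all edges it is made of, plus one copy of the label of $y$ for each of the two junctions that it contains (some of the four edges around the pair may coincide, in which case the two strands become a single edge, or close up to circles). An \emph{attractor point} of $g$ is a point $x$ fixed by some $g^k$, $k\ge1$, which has a neighbourhood $U$ with $g^k(U)\subseteq U$ whose images $g^{kn}(U)$ are eventually contained in every given neighbourhood of $x$. A \emph{repellor point} of $g$ is an attractor point of $g^{-1}$. \textbf{Theorem.} Let $g\in V$ be represented by a strand diagram, and let $\Gamma_0$ be this diagram written on a cylinder, with its labels. Rule I can be applied to any diagram obtained from $\Gamma_0$ that has a merge-split pair, and there is no infinite sequence of applications starting at $\Gamma_0$. Let $\Gamma$ be any diagram obtained from $\Gamma_0$ by applications of the labelled Rule I until no merge-split pair is left. (1) If $\Gamma$ has no carets, i.e. is a finite union of circles, then $g$ is torsion, and its order is the least common multiple of the labels of $\Gamma$. (2) If some carets remain in $\Gamma$, then $g$ has infinite order. Moreover $\Gamma$ contains a directed cycle all of whose carets are merges (an attractor cycle) and a directed cycle all of whose carets are splits. For each directed cycle of merges (resp. of splits) there is an attractor point (resp. a repellor point) of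 $g$ whose orbit is finite and has as its length the sum of the labels along the cycle. The set of lengths of finite orbits of $g$ on $\mathfrak C$ is exactly the set of the label sums along the simple directed cycles of $\Gamma$, where circles count as cycles. -/

import Mathlib

open Function Topology

/-- The Cantor set of infinite binary words. -/
abbrev Cantor : Type := ℕ → Bool

namespace Cantor

/-- The infinite word `b w`. -/
def cons (b : Bool) (w : Cantor) : Cantor
  | 0 => b
  | n + 1 => w n

/-- The infinite word `u w`, for a finite word `u`. -/
def append : List Bool → Cantor → Cantor
  | [], w => w
  | b :: u, w => cons b (append u w)

theorem cons_injective (b : Bool) : Injective (cons b) := fun _ _ h =>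
  funext fun n => congrFun h (n + 1)

theorem append_injective (u : List Bool) : Injective (append u) := by
  induction u with
  | nil => exact fun _ _ h => h
  | cons b u ih => exact fun _ _ h => ih (cons_injective b h)

theorem append_append (u v : List Bool) (w : Cantor) :
    append (u ++ v) w = append u (append v w) := by
  induction u with
  | nil => rfl
  | cons b u ih => simp [append, ih]

/-- Two finite prefixes of the same infinite word are comparable. -/
theorem comparable (u : List Bool) : ∀ (v : List Bool) (w w' : Cantor),
    append u w = append v w' → (∃ t, v = u ++ t) ∨ (∃ t, u = v ++ t) := by
  induction u with
  | nil => exact fun v _ _ _ => Or.inl ⟨v, rfl⟩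
  | cons b u ih =>
    intro v w w' h
    cases v with
    | nil => exact Or.inr ⟨b :: u, rfl⟩
    | cons c v =>
      have h0 : b = c := congrFun h 0
      have h1 : append u w = append v w' := funext fun n => congrFun h (n + 1)
      subst h0
      rcases ih v w w' h1 with ⟨t, rfl⟩ | ⟨t, rfl⟩
      · exact Or.inl ⟨t, rfl⟩
      · exact Or.inr ⟨t, rfl⟩

end Cantor

/-- Thompson's group `V`: the homeomorphisms of the Cantor set which are locally of the form
`u w ↦ v w`, that is, which replace a finite prefix by another one. -/
def ThompsonV : Subgroup (Cantor ≃ₜ Cantor) where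
  carrier := {g | ∀ x : Cantor, ∃ u v : List Bool,
    (∃ w, x = Cantor.append u w) ∧ ∀ w, g (Cantor.append u w) = Cantor.append v w}
  one_mem' := fun x => ⟨[], [], ⟨x, rfl⟩, fun _ => rfl⟩
  mul_mem' := by
    intro f g hf hg x
    obtain ⟨u, v, ⟨w, rfl⟩, h⟩ := hg x
    obtain ⟨u', v', ⟨w', hw'⟩, h'⟩ := hf (g (Cantor.append u w))
    rw [h] at hw'
    rcases Cantor.comparable _ _ _ _ hw' with ⟨t, rfl⟩ | ⟨t, rfl⟩
    · rw [Cantor.append_append] at hw'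
      have hw := Cantor.append_injective _ hw'
      refine ⟨u ++ t, v', ⟨w', ?_⟩, fun w => ?_⟩
      · rw [Cantor.append_append, hw]
      · change f (g _) = _
        rw [Cantor.append_append, h, ← Cantor.append_append, h']
    · refine ⟨u, v' ++ t, ⟨w, rfl⟩, fun w => ?_⟩
      change f (g _) = _
      rw [h, Cantor.append_append, h', Cantor.append_append]
  inv_mem' := by
    intro g hg y
    obtain ⟨u, v, ⟨w, hw⟩, h⟩ := hg (g.symm y)
    refine ⟨v, u, ⟨w, ?_⟩, fun w => ?_⟩
    · rw [← h, ← hw, g.apply_symm_apply]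
    · change g.symm _ = _
      rw [← h, g.symm_apply_apply]

/-! ### Strand diagrams

The carets of a diagram are splits (one incoming edge, a left and a right outgoing edge) and merges
(a left and a right incoming edge, one outgoing edge).  `false` stands for left and `true` for
right; naming the left and the right edge at each caret is the same as giving a rotation system. -/

/-- The places where an edge can start: the two outputs of a split, the output of a merge. -/
abbrev OutPort (S M : Type) : Type := (S × Bool) ⊕ M

/-- The places where an edge can end: the input of a split, the two inputs of a merge. -/
abbrev InPort (S M : Type) : Type := S ⊕ (M × Bool)

/-- The edge `e'` directly follows the edge `e` at some caret. -/
inductive Follows {E S M : Type} (out : OutPort S M → E) (inn : InPort S M → E) : E → E → Prop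
  | split (s : S) (b : Bool) : Follows out inn (inn (.inl s)) (out (.inl (s, b)))
  | merge (m : M) (b : Bool) : Follows out inn (inn (.inr (m, b))) (out (.inr m))

/-- An infinite word travelling along the edges crosses one caret: a split removes its first
letter and sends it left or right accordingly, a merge adds the letter of the side it comes
from. -/
inductive Travel {E S M : Type} (out : OutPort S M → E) (inn : InPort S M → E) :
    E × Cantor → E × Cantor → Prop
  | split (s : S) (b : Bool) (w : Cantor) :
      Travel out inn (inn (.inl s), Cantor.cons b w) (out (.inl (s, b)), w)
  | merge (m : M) (b : Bool) (w : Cantor) :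
      Travel out inn (inn (.inr (m, b)), w) (out (.inr m), Cantor.cons b w)

/-- A strand diagram with one source and one sink: a finite acyclic digraph whose vertices are a
univalent source, a univalent sink, splits and merges. The source is the output `none` and the sink
is the input `none`; every edge has exactly one start and exactly one end. -/
structure StrandDiagram where
  Edge : Type
  Split : Type
  Merge : Type
  [fintypeEdge : Fintype Edge]
  [fintypeSplit : Fintype Split]
  [fintypeMerge : Fintype Merge]
  out : Option (OutPort Split Merge) → Edge
  inn : Option (InPort Split Merge) → Edge
  out_bijective : Bijective out
  inn_bijective : Bijective inn
  acyclic : ∀ e, ¬ Relation.TransGen (Follows (fun o => out (some o)) (fun i => inn (some i))) e e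

attribute [instance] StrandDiagram.fintypeEdge StrandDiagram.fintypeSplit
  StrandDiagram.fintypeMerge

/-- A labelled strand diagram on a cylinder, without its embedding: a finite digraph of splits and
merges with a natural number on each edge. An edge which starts and ends nowhere is a circle;
every other edge has exactly one start and exactly one end. -/
structure CylinderDiagram where
  Edge : Type
  Split : Type
  Merge : Type
  [fintypeEdge : Fintype Edge]
  [fintypeSplit : Fintype Split]
  [fintypeMerge : Fintype Merge]
  out : OutPort Split Merge → Edge
  inn : InPort Split Merge → Edge
  out_injective : Injective out
  inn_injective : Injective inn
  range_eq : Set.range out = Set.range inn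
  label : Edge → ℕ

attribute [instance] CylinderDiagram.fintypeEdge CylinderDiagram.fintypeSplit
  CylinderDiagram.fintypeMerge

namespace StrandDiagram

variable (P : StrandDiagram)

/-- The edge leaving the source. -/
def sourceEdge : P.Edge := P.out none

/-- The edge entering the sink. -/
def sinkEdge : P.Edge := P.inn none

/-- The diagram represents `g`: a word `w` put on the source edge arrives at the sink edge
as `g w`. -/
def Represents (g : Cantor ≃ₜ Cantor) : Prop :=
  ∀ w, Relation.ReflTransGen (Travel (fun o => P.out (some o)) (fun i => P.inn (some i)))
    (P.sourceEdge, w) (P.sinkEdge, g w)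

open Classical in
/-- The edges of the diagram on the cylinder: the sink edge is glued to the source edge. -/
noncomputable def glue (e : P.Edge) : {e : P.Edge // e = P.sourceEdge ∨ e ≠ P.sinkEdge} :=
  if h : e = P.sinkEdge then ⟨P.sourceEdge, Or.inl rfl⟩ else ⟨e, Or.inr h⟩

theorem glue_eq_iff (a b : P.Edge) : P.glue a = P.glue b ↔
    a = b ∨ (a = P.sourceEdge ∧ b = P.sinkEdge) ∨ (a = P.sinkEdge ∧ b = P.sourceEdge) := by
  unfold glue
  split_ifs with h1 h2 h2 <;> simp only [Subtype.mk.injEq] <;> grind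

theorem out_some_ne (o : OutPort P.Split P.Merge) : P.out (some o) ≠ P.sourceEdge := fun h => by
  simpa using P.out_bijective.1 h

theorem inn_some_ne (i : InPort P.Split P.Merge) : P.inn (some i) ≠ P.sinkEdge := fun h => by
  simpa using P.inn_bijective.1 h

theorem exists_out {e : P.Edge} (h : e ≠ P.sourceEdge) : ∃ o, P.out (some o) = e := by
  obtain ⟨o, rfl⟩ := P.out_bijective.2 e
  cases o with
  | none => exact absurd rfl h
  | some o => exact ⟨o, rfl⟩

theorem exists_inn {e : P.Edge} (h : e ≠ P.sinkEdge) : ∃ i, P.inn (some i) = e := by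
  obtain ⟨i, rfl⟩ := P.inn_bijective.2 e
  cases i with
  | none => exact absurd rfl h
  | some i => exact ⟨i, rfl⟩

open Classical in
/-- The diagram written on a cylinder: the sink is glued to the source (and the resulting bivalent
vertex removed); the edge crossing the seam has label `1` and all other edges have label `0`. -/
noncomputable def onCylinder : CylinderDiagram where
  Edge := {e : P.Edge // e = P.sourceEdge ∨ e ≠ P.sinkEdge}
  Split := P.Split
  Merge := P.Merge
  out o := P.glue (P.out (some o))
  inn i := P.glue (P.inn (some i))
  out_injective := by
    intro a b h
    rcases (P.glue_eq_iff _ _).1 h with h | h | h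
    · simpa using P.out_bijective.1 h
    · exact absurd h.1 (P.out_some_ne a)
    · exact absurd h.2 (P.out_some_ne b)
  inn_injective := by
    intro a b h
    rcases (P.glue_eq_iff _ _).1 h with h | h | h
    · simpa using P.inn_bijective.1 h
    · exact absurd h.2 (P.inn_some_ne b)
    · exact absurd h.1 (P.inn_some_ne a)
  range_eq := by
    ext e
    constructor
    · rintro ⟨o, rfl⟩
      by_cases h : P.out (some o) = P.sinkEdge
      · have h2 : P.sourceEdge ≠ P.sinkEdge := fun h' => P.out_some_ne o (h.trans h'.symm)
        obtain ⟨i, hi⟩ := P.exists_inn h2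
        exact ⟨i, (P.glue_eq_iff _ _).2 (Or.inr (Or.inl ⟨hi, h⟩))⟩
      · obtain ⟨i, hi⟩ := P.exists_inn h
        exact ⟨i, by simp only [hi]⟩
    · rintro ⟨i, rfl⟩
      by_cases h : P.inn (some i) = P.sourceEdge
      · have h2 : P.sinkEdge ≠ P.sourceEdge := fun h' => P.inn_some_ne i (h.trans h'.symm)
        obtain ⟨o, ho⟩ := P.exists_out h2
        exact ⟨o, (P.glue_eq_iff _ _).2 (Or.inr (Or.inr ⟨ho, h⟩))⟩
      · obtain ⟨o, ho⟩ := P.exists_out h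
        exact ⟨o, by simp only [ho]⟩
  label e := if e.1 = P.sourceEdge then 1 else 0

end StrandDiagram

namespace CylinderDiagram

/-- The edge `y` leads from the merge `m` to the split `s`. -/
def IsMergeSplit (D : CylinderDiagram) (m : D.Merge) (s : D.Split) (y : D.Edge) : Prop :=
  D.out (.inr m) = y ∧ D.inn (.inl s) = y

/-- No merge-split pair is left. -/
def IsReduced (D : CylinderDiagram) : Prop := ¬ ∃ m s y, D.IsMergeSplit m s y

/-- The diagram is a union of circles: it has no caret. -/
def IsUnionOfCircles (D : CylinderDiagram) : Prop := IsEmpty D.Split ∧ IsEmpty D.Merge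

open Classical in
/-- `D'` is obtained from `D` by one application of the labelled Rule I.  A merge `m` and a
split `s` joined by an edge `y` are removed together with `y`; the left (right) incoming edge of `m`
is joined to the left (right) outgoing edge of `s`, and `joined a` is the edge of `D'` containing
the edge `a` of `D`.  (The value of `joined` at the removed edge `y` is irrelevant.)  The label of
an edge of `D'` is the sum of the labels of the edges of `D` it contains, plus a copy of the
label of `y` for each of the two (left, right) junctions that it contains.  When some of the four edges around the pair
coincide, the two strands may become one, and they may close up to circles. -/
def RuleI (D D' : CylinderDiagram) : Prop :=
  ∃ (m : D.Merge) (s : D.Split) (y : D.Edge)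
    (joined : D.Edge → D'.Edge)
    (keptSplit : D'.Split ≃ {t : D.Split // t ≠ s})
    (keptMerge : D'.Merge ≃ {n : D.Merge // n ≠ m}),
    D.IsMergeSplit m s y ∧
    (∀ e', ∃ a, a ≠ y ∧ joined a = e') ∧
    (∀ a b, a ≠ y → b ≠ y → (joined a = joined b ↔
      Relation.EqvGen
        (fun a b => ∃ i : Bool, a = D.inn (.inr (m, i)) ∧ b = D.out (.inl (s, i))) a b)) ∧
    (∀ t, D'.inn (.inl t) = joined (D.inn (.inl (keptSplit t)))) ∧
    (∀ t i, D'.out (.inl (t, i)) = joined (D.out (.inl (keptSplit t, i)))) ∧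
    (∀ n i, D'.inn (.inr (n, i)) = joined (D.inn (.inr (keptMerge n, i)))) ∧
    (∀ n, D'.out (.inr n) = joined (D.out (.inr (keptMerge n)))) ∧
    ∀ e', D'.label e' = (∑ a : D.Edge, if a ≠ y ∧ joined a = e' then D.label a else 0) +
      ∑ i : Bool, if joined (D.inn (.inr (m, i))) = e' then D.label y else 0

/-- `D'` is obtained from `D` by finitely many (possibly no) applications of Rule I. -/
def Reduces : CylinderDiagram → CylinderDiagram → Prop := Relation.ReflTransGen RuleI

variable (D : CylinderDiagram)

/-- The edge is a circle: it meets no caret. -/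
def IsCircle (e : D.Edge) : Prop := e ∉ Set.range D.out

/-- `c 0, c 1, …, c k` are the (distinct) edges of a directed cycle through carets. -/
def IsCycle {k : ℕ} (c : Fin (k + 1) → D.Edge) : Prop :=
  Injective c ∧ ∀ i, Follows D.out D.inn (c i) (c (i + 1))

/-- A directed cycle all of whose carets are merges. -/
def IsMergeCycle {k : ℕ} (c : Fin (k + 1) → D.Edge) : Prop :=
  D.IsCycle c ∧ ∀ i, ∃ m b, c i = D.inn (.inr (m, b))

/-- A directed cycle all of whose carets are splits. -/
def IsSplitCycle {k : ℕ} (c : Fin (k + 1) → D.Edge) : Prop :=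
  D.IsCycle c ∧ ∀ i, ∃ s, c i = D.inn (.inl s)

/-- The sum of the labels along a cycle. -/
def labelSum {k : ℕ} (c : Fin (k + 1) → D.Edge) : ℕ := ∑ i, D.label (c i)

/-- The label sums along all oriented cycles: the label of each circle, and the sum of the labels
along each directed cycle through carets. -/
def cycleSums : Set ℕ :=
  {n | (∃ e, D.IsCircle e ∧ D.label e = n) ∨
    ∃ (k : ℕ) (c : Fin (k + 1) → D.Edge), D.IsCycle c ∧ D.labelSum c = n}

end CylinderDiagram

/-! ### Dynamics on the Cantor set -/

/-- The orbit of `x` under the powers of `g`. -/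
def orbitOf (g : Cantor ≃ₜ Cantor) (x : Cantor) : Set Cantor :=
  Set.range fun n : ℤ => (g ^ n) x

/-- The lengths of the finite orbits of `g`. -/
def finiteOrbitLengths (g : Cantor ≃ₜ Cantor) : Set ℕ :=
  {n | ∃ x, (orbitOf g x).Finite ∧ (orbitOf g x).ncard = n}

/-- `x` is an attractor point of `g`: some positive power of `g` fixes `x` and maps some
neighbourhood `U` of `x` into itself, and its iterates contract `U` to `x`. -/
def IsAttractor (g : Cantor ≃ₜ Cantor) (x : Cantor) : Prop :=
  ∃ k : ℕ, 0 < k ∧ (g ^ k) x = x ∧ ∃ U ∈ 𝓝 x, Set.MapsTo (g ^ k) U U ∧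
    ∀ W ∈ 𝓝 x, ∃ N : ℕ, ∀ n ≥ N, Set.MapsTo ((g ^ k) ^ n) U W

/-- `x` is a repellor point of `g`: an attractor point of the inverse of `g`. -/
def IsRepellor (g : Cantor ≃ₜ Cantor) (x : Cantor) : Prop := IsAttractor g⁻¹ x

/-! Let a word run along the edges of a cylinder diagram, with a clock that falls by the label of
each edge it leaves. This `flow` permutes the triples (edge, word, time). A map `Ψ` with `IsModel`
identifies its orbit space with the Cantor set in such a way that setting the clock forward by one
is the action of `g`. The diagram written on the cylinder has a model (`Represents.exists_isModel`),
because one turn crosses the seam once and applies `g`. Models survive Rule I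
(`IsModel.exists_of_ruleI`): a merge followed by a split adds a letter and takes it off again, so
only time passes, and the new labels record this time.

For a reduced diagram the dynamics can be read off. The power `g ^ m` fixes the point of `(e, w, n)`
exactly when the flow joins `(e, w, n + m)` to `(e, w, n)`. On a circle the word never changes and
the period is the label. Off the circles, a path leaving a merge meets only merges from then on, and
a path followed backwards from a split meets only splits, so every edge has a forced future or a
forced past. Around a cycle of merges the first return only adds letters; it is a contraction of the
Cantor set with one fixed word, which gives an attractor whose period is the label sum, and no other
word on that edge is periodic. Cycles of splits behave in the same way under the inverse flow
(`IsContractingReturn.of_cycle` covers both). Hence carets force infinite order, and every finite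
orbit comes from a circle or from one of these cycles. -/

namespace Cantor

/-! ### Words, contractions and neighbourhoods. -/

/-- The infinite word without its first letter. -/
def tail (w : Cantor) : Cantor := fun n => w (n + 1)

@[simp] theorem cons_zero (b : Bool) (w : Cantor) : cons b w 0 = b := rfl

@[simp] theorem cons_succ (b : Bool) (w : Cantor) (n : ℕ) : cons b w (n + 1) = w n := rfl

@[simp] theorem tail_cons (b : Bool) (w : Cantor) : tail (cons b w) = w := rfl

@[simp] theorem cons_tail (w : Cantor) : cons (w 0) (tail w) = w := by
  funext n
  cases n <;> rfl

theorem continuous_cons (b : Bool) : Continuous (cons b) := by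
  refine continuous_pi fun n => ?_
  cases n with
  | zero => exact continuous_const
  | succ n => exact continuous_apply n

theorem continuous_tail : Continuous tail :=
  continuous_pi fun n => continuous_apply (n + 1)

/-- A map of infinite words which increases the length of the common prefix. -/
def IsContracting (f : Cantor → Cantor) : Prop :=
  ∀ (N : ℕ) (w w' : Cantor), (∀ i < N, w i = w' i) → ∀ i < N + 1, f w i = f w' i

theorem IsContracting.cons {f : Cantor → Cantor} (b : Bool) (hf : f = id ∨ IsContracting f) :
    IsContracting fun w => cons b (f w) := by
  intro N w w' h i hi
  cases i with
  | zero => rfl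
  | succ i =>
    rcases hf with rfl | hf
    · exact h i (by omega)
    · exact hf N w w' h i (by omega)

/-- Each application gains one letter of agreement, starting from none, so the estimate is uniform
in the two words. -/
theorem IsContracting.iterate_apply_eq {f : Cantor → Cantor} (hf : IsContracting f) (n : ℕ)
    (w w' : Cantor) : ∀ i < n, f^[n] w i = f^[n] w' i := by
  induction n with
  | zero => intro i hi; omega
  | succ n ih =>
    rw [iterate_succ_apply', iterate_succ_apply']
    exact hf n _ _ ih

theorem IsContracting.exists_fixed {f : Cantor → Cantor} (hf : IsContracting f) :
    ∃ w, f w = w := by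
  let w₀ : Cantor := fun _ => false
  have key : ∀ n m i, i < n → n ≤ m → f^[m] w₀ i = f^[n] w₀ i := by
    intro n m i hi hm
    obtain ⟨k, rfl⟩ := Nat.exists_eq_add_of_le hm
    rw [iterate_add_apply]
    exact hf.iterate_apply_eq n _ _ i hi
  -- Letter `n` is settled from the iterate `n + 1` on; the limit is read off diagonally.
  refine ⟨fun n => f^[n + 1] w₀ n, ?_⟩
  funext n
  have := hf n (fun n => f^[n + 1] w₀ n) (f^[n] w₀)
    (fun i hi => (key (i + 1) n i (by omega) (by omega)).symm) n (by omega)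
  rw [this, iterate_succ_apply']

theorem IsContracting.eq_of_iterate_eq {f : Cantor → Cantor} (hf : IsContracting f)
    {w w' : Cantor} (hw : f w = w) {q : ℕ} (hq : 0 < q) (hw' : f^[q] w' = w') : w' = w := by
  funext i
  -- Both words are fixed by this iterate, and its exponent exceeds `i`, so it determines letter
  -- `i`.
  have h1 : f^[q * (i + 1)] w' = w' := by
    rw [iterate_mul]; exact iterate_fixed hw' _
  have h2 : f^[q * (i + 1)] w = w := iterate_fixed hw _
  rw [← h1, ← h2]
  exact hf.iterate_apply_eq _ _ _ i (by nlinarith)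

theorem mem_nhds_iff_agree {w : Cantor} {V : Set Cantor} :
    V ∈ 𝓝 w ↔ ∃ N : ℕ, ∀ w' : Cantor, (∀ i < N, w' i = w i) → w' ∈ V := by
  constructor
  · intro h
    rw [nhds_pi, Filter.mem_pi] at h
    obtain ⟨I, hI, t, ht, hV⟩ := h
    obtain ⟨N, hN⟩ := hI.bddAbove
    refine ⟨N + 1, fun w' h => hV fun i hi => ?_⟩
    rw [h i (Nat.lt_succ_of_le (hN hi))]
    exact mem_of_mem_nhds (ht i)
  · rintro ⟨N, h⟩
    have : ∀ᶠ w' : Cantor in 𝓝 w, ∀ i ∈ Finset.range N, w' i = w i := by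
      rw [Filter.eventually_all_finset]
      intro i _
      have : Filter.Tendsto (fun w' : Cantor => w' i) (𝓝 w) (𝓝 (w i)) :=
        (continuous_apply i).continuousAt
      rw [nhds_discrete Bool, Filter.tendsto_pure] at this
      exact this
    filter_upwards [this] with w' hw'
    exact h w' fun i hi => hw' i (Finset.mem_range.2 hi)

/-- Flipping a far letter stays close. The absence of isolated points later excludes return time
zero. -/
theorem singleton_notMem_nhds (w : Cantor) : {w} ∉ 𝓝 w := by
  rw [mem_nhds_iff_agree]
  rintro ⟨N, h⟩
  have h1 : Function.update w N (!w N) = w := h _ fun i hi => by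
    rw [Function.update_of_ne hi.ne]
  have := congrFun h1 N
  simp at this

theorem exists_ne_word (w : Cantor) : ∃ w', w' ≠ w :=
  ⟨fun n => !w n, fun h => by simpa using congrFun h 0⟩

end Cantor

/-! ### The flow and its orbit space. -/

namespace CylinderDiagram

variable (D : CylinderDiagram)

instance : TopologicalSpace D.Edge := ⊥

instance : DiscreteTopology D.Edge := ⟨rfl⟩

/-- The points of the flow: an edge, a word at the start of this edge, and a time. -/
abbrev FlowSpace : Type := D.Edge × Cantor × ℤ

open Classical in
/-- A word travels to the next edge, and time decreases by the label of the edge it leaves. -/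
noncomputable def flowFun (p : D.FlowSpace) : D.FlowSpace :=
  if h : ∃ i, D.inn i = p.1 then
    match h.choose with
    | .inl s => (D.out (.inl (s, p.2.1 0)), p.2.1.tail, p.2.2 - D.label p.1)
    | .inr (m, b) => (D.out (.inr m), Cantor.cons b p.2.1, p.2.2 - D.label p.1)
  else (p.1, p.2.1, p.2.2 - D.label p.1)

open Classical in
/-- The inverse of the flow. -/
noncomputable def flowInv (p : D.FlowSpace) : D.FlowSpace :=
  if h : ∃ o, D.out o = p.1 then
    match h.choose with
    | .inl (s, b) => (D.inn (.inl s), Cantor.cons b p.2.1, p.2.2 + D.label (D.inn (.inl s)))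
    | .inr m => (D.inn (.inr (m, p.2.1 0)), p.2.1.tail,
        p.2.2 + D.label (D.inn (.inr (m, p.2.1 0))))
  else (p.1, p.2.1, p.2.2 + D.label p.1)

variable {D}

theorem flowFun_split (s : D.Split) (w : Cantor) (n : ℤ) :
    D.flowFun (D.inn (.inl s), w, n) =
      (D.out (.inl (s, w 0)), w.tail, n - D.label (D.inn (.inl s))) := by
  have h : ∃ i, D.inn i = D.inn (.inl s) := ⟨_, rfl⟩
  -- An edge ends at no more than one port, so the choice in `flowFun` is forced.
  have h' : h.choose = .inl s := D.inn_injective h.choose_spec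
  simp only [flowFun, dif_pos h]
  rw [h']

theorem flowFun_merge (m : D.Merge) (b : Bool) (w : Cantor) (n : ℤ) :
    D.flowFun (D.inn (.inr (m, b)), w, n) =
      (D.out (.inr m), Cantor.cons b w, n - D.label (D.inn (.inr (m, b)))) := by
  have h : ∃ i, D.inn i = D.inn (.inr (m, b)) := ⟨_, rfl⟩
  have h' : h.choose = .inr (m, b) := D.inn_injective h.choose_spec
  simp only [flowFun, dif_pos h]
  rw [h']

theorem flowFun_circle {e : D.Edge} (he : D.IsCircle e) (w : Cantor) (n : ℤ) :
    D.flowFun (e, w, n) = (e, w, n - D.label e) := by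
  have h : ¬ ∃ i, D.inn i = e := by
    rw [IsCircle, D.range_eq] at he; exact he
  simp only [flowFun, dif_neg h]

theorem flowInv_split (s : D.Split) (b : Bool) (w : Cantor) (n : ℤ) :
    D.flowInv (D.out (.inl (s, b)), w, n) =
      (D.inn (.inl s), Cantor.cons b w, n + D.label (D.inn (.inl s))) := by
  have h : ∃ i, D.out i = D.out (.inl (s, b)) := ⟨_, rfl⟩
  have h' : h.choose = .inl (s, b) := D.out_injective h.choose_spec
  simp only [flowInv, dif_pos h]
  rw [h']

theorem flowInv_merge (m : D.Merge) (w : Cantor) (n : ℤ) :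
    D.flowInv (D.out (.inr m), w, n) =
      (D.inn (.inr (m, w 0)), w.tail, n + D.label (D.inn (.inr (m, w 0)))) := by
  have h : ∃ i, D.out i = D.out (.inr m) := ⟨_, rfl⟩
  have h' : h.choose = .inr m := D.out_injective h.choose_spec
  simp only [flowInv, dif_pos h]
  rw [h']

theorem flowInv_circle {e : D.Edge} (he : D.IsCircle e) (w : Cantor) (n : ℤ) :
    D.flowInv (e, w, n) = (e, w, n + D.label e) := by
  have h : ¬ ∃ i, D.out i = e := he
  simp only [flowInv, dif_neg h]

theorem edge_cases_inn (e : D.Edge) :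
    (∃ s, e = D.inn (.inl s)) ∨ (∃ m b, e = D.inn (.inr (m, b))) ∨ D.IsCircle e := by
  by_cases h : e ∈ Set.range D.inn
  · obtain ⟨s | ⟨m, b⟩, rfl⟩ := h
    · exact Or.inl ⟨s, rfl⟩
    · exact Or.inr (Or.inl ⟨m, b, rfl⟩)
  · rw [← D.range_eq] at h
    exact Or.inr (Or.inr h)

theorem edge_cases_out (e : D.Edge) :
    (∃ s b, e = D.out (.inl (s, b))) ∨ (∃ m, e = D.out (.inr m)) ∨ D.IsCircle e := by
  by_cases h : e ∈ Set.range D.out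
  · obtain ⟨⟨s, b⟩ | m, rfl⟩ := h
    · exact Or.inl ⟨s, b, rfl⟩
    · exact Or.inr (Or.inl ⟨m, rfl⟩)
  · exact Or.inr (Or.inr h)

theorem flowInv_flowFun (p : D.FlowSpace) : D.flowInv (D.flowFun p) = p := by
  obtain ⟨e, w, n⟩ := p
  rcases edge_cases_inn e with ⟨s, rfl⟩ | ⟨m, b, rfl⟩ | he
  · rw [flowFun_split, flowInv_split]; simp
  · rw [flowFun_merge, flowInv_merge]; simp
  · rw [flowFun_circle he, flowInv_circle he]; simp

theorem flowFun_flowInv (p : D.FlowSpace) : D.flowFun (D.flowInv p) = p := by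
  obtain ⟨e, w, n⟩ := p
  rcases edge_cases_out e with ⟨s, b, rfl⟩ | ⟨m, rfl⟩ | he
  · rw [flowInv_split, flowFun_split]; simp
  · rw [flowInv_merge, flowFun_merge]; simp
  · rw [flowInv_circle he, flowFun_circle he]; simp

variable (D) in
/-- The flow of the diagram. -/
noncomputable def flow : Equiv.Perm D.FlowSpace where
  toFun := D.flowFun
  invFun := D.flowInv
  left_inv := flowInv_flowFun
  right_inv := flowFun_flowInv

theorem flow_split (s : D.Split) (w : Cantor) (n : ℤ) :
    D.flow (D.inn (.inl s), w, n) =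
      (D.out (.inl (s, w 0)), w.tail, n - D.label (D.inn (.inl s))) := flowFun_split s w n

theorem flow_merge (m : D.Merge) (b : Bool) (w : Cantor) (n : ℤ) :
    D.flow (D.inn (.inr (m, b)), w, n) =
      (D.out (.inr m), Cantor.cons b w, n - D.label (D.inn (.inr (m, b)))) :=
  flowFun_merge m b w n

theorem flow_circle {e : D.Edge} (he : D.IsCircle e) (w : Cantor) (n : ℤ) :
    D.flow (e, w, n) = (e, w, n - D.label e) := flowFun_circle he w n

theorem flow_inv_split (s : D.Split) (b : Bool) (w : Cantor) (n : ℤ) :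
    D.flow⁻¹ (D.out (.inl (s, b)), w, n) =
      (D.inn (.inl s), Cantor.cons b w, n + D.label (D.inn (.inl s))) := flowInv_split s b w n

theorem continuous_flowFun : Continuous D.flowFun := by
  rw [continuous_prod_of_discrete_left]
  intro e
  rw [continuous_prod_of_discrete_right]
  intro n
  rcases edge_cases_inn e with ⟨s, rfl⟩ | ⟨m, b, rfl⟩ | he
  · simp only [flowFun_split]
    refine Continuous.prodMk ?_ (Cantor.continuous_tail.prodMk continuous_const)
    exact (continuous_of_discreteTopology (f := fun b => D.out (.inl (s, b)))).comp
      (continuous_apply 0)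
  · simp only [flowFun_merge]
    exact continuous_const.prodMk ((Cantor.continuous_cons b).prodMk continuous_const)
  · simp only [flowFun_circle he]
    exact continuous_const.prodMk (continuous_id.prodMk continuous_const)

theorem continuous_flowInv : Continuous D.flowInv := by
  rw [continuous_prod_of_discrete_left]
  intro e
  rw [continuous_prod_of_discrete_right]
  intro n
  rcases edge_cases_out e with ⟨s, b, rfl⟩ | ⟨m, rfl⟩ | he
  · simp only [flowInv_split]
    exact continuous_const.prodMk ((Cantor.continuous_cons b).prodMk continuous_const)
  · simp only [flowInv_merge]
    refine Continuous.prodMk ?_ (Cantor.continuous_tail.prodMk ?_)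
    · exact (continuous_of_discreteTopology (f := fun b => D.inn (.inr (m, b)))).comp
        (continuous_apply 0)
    · exact (continuous_of_discreteTopology
        (f := fun b => n + (D.label (D.inn (.inr (m, b))) : ℤ))).comp (continuous_apply 0)
  · simp only [flowInv_circle he]
    exact continuous_const.prodMk (continuous_id.prodMk continuous_const)

variable (D) in
/-- The flow as a homeomorphism. -/
noncomputable def flowHomeo : D.FlowSpace ≃ₜ D.FlowSpace where
  toEquiv := D.flow
  continuous_toFun := continuous_flowFun
  continuous_invFun := continuous_flowInv

theorem flowHomeo_zpow_apply (k : ℤ) (p : D.FlowSpace) :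
    (D.flowHomeo ^ k) p = (D.flow ^ k) p := by
  let φ : (D.FlowSpace ≃ₜ D.FlowSpace) →* Equiv.Perm D.FlowSpace :=
    { toFun := fun h => h.toEquiv, map_one' := rfl, map_mul' := fun _ _ => rfl }
  have := map_zpow φ D.flowHomeo k
  exact congrArg (fun h : Equiv.Perm D.FlowSpace => h p) this

/-- `Ψ` identifies the orbit space of the flow, with the shift of time, with the Cantor set and the
action of `g`. -/
structure IsModel (D : CylinderDiagram) (g : Cantor ≃ₜ Cantor) (Ψ : D.FlowSpace → Cantor) :
    Prop where
  shift : ∀ e w n, Ψ (e, w, n + 1) = g (Ψ (e, w, n))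
  surjective : Surjective Ψ
  eq_iff : ∀ p q, Ψ p = Ψ q ↔ D.flow.SameCycle p q
  map_nhds : ∀ e w n, Filter.map (fun w => Ψ (e, w, n)) (𝓝 w) = 𝓝 (Ψ (e, w, n))
  pos : ∀ p, ∃ q, D.flow.SameCycle p q ∧ 0 < D.label q.1

theorem IsModel.shift_zpow {g : Cantor ≃ₜ Cantor} {Ψ : D.FlowSpace → Cantor}
    (h : D.IsModel g Ψ) (e : D.Edge) (w : Cantor) (n m : ℤ) :
    Ψ (e, w, n + m) = (g ^ m) (Ψ (e, w, n)) := by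
  induction m with
  | zero => simp
  | succ m ih =>
    rw [← add_assoc, h.shift, ih, add_comm, zpow_add, zpow_one]; rfl
  | pred m ih =>
    rw [sub_eq_neg_add, zpow_add, zpow_neg_one]
    change _ = g.symm ((g ^ _) _)
    rw [← ih, Homeomorph.eq_symm_apply, ← h.shift]
    congr 3
    ring

end CylinderDiagram

/-! ### Joining edges at two junctions -/

section Junctions

variable {E : Type} {a b : Bool → E}

/-- The edge `x` is joined to the edge `z` at one of the two junctions. -/
def Junction (a b : Bool → E) (x z : E) : Prop := ∃ i, x = a i ∧ z = b i

theorem Junction.flip_iff {x z : E} : Junction a b x z ↔ Junction b a z x :=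
  exists_congr fun _ => and_comm

/-- `Junction a b` is a partial injection, so an equivalence class is a single chain or a circle,
and of two members one is reached from the other. -/
theorem reflTransGen_or_of_eqvGen (ha : Injective a) (hb : Injective b) {x z : E}
    (h : Relation.EqvGen (Junction a b) x z) :
    Relation.ReflTransGen (Junction a b) x z ∨ Relation.ReflTransGen (Junction a b) z x := by
  have key : ∀ {a b : Bool → E}, Injective a → Relator.RightUnique (Junction a b) := by
    rintro a b ha x z z' ⟨i, rfl, rfl⟩ ⟨j, hj, rfl⟩
    rw [ha hj]
  have hswap : ∀ x z, Relation.ReflTransGen (Junction a b) x z ↔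
      Relation.ReflTransGen (Junction b a) z x := by
    intro x z
    rw [← Relation.reflTransGen_swap]
    have : Function.swap (Junction a b) = Junction b a := by
      funext x z; exact propext Junction.flip_iff
    rw [this]
  induction h with
  | rel x z h => exact Or.inl (.single h)
  | refl x => exact Or.inl .refl
  | symm x z _ ih => exact ih.symm
  | trans x t z _ _ ih₁ ih₂ =>
    rcases ih₁ with h₁ | h₁ <;> rcases ih₂ with h₂ | h₂
    · exact Or.inl (h₁.trans h₂)
    · rw [hswap] at h₁ h₂
      rw [hswap, hswap]
      exact (Relation.ReflTransGen.total_of_right_unique (key hb) h₁ h₂).symm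
    · exact Relation.ReflTransGen.total_of_right_unique (key ha) h₁ h₂
    · exact Or.inr (h₂.trans h₁)

/-- An edge outside the range of `a` has no successor: it is the last one of its strand, and a
strand has at most one last edge. -/
theorem eq_of_eqvGen_of_notMem_range_left (ha : Injective a) (hb : Injective b) {x z : E}
    (h : Relation.EqvGen (Junction a b) x z) (hx : x ∉ Set.range a) (hz : z ∉ Set.range a) :
    x = z := by
  rcases reflTransGen_or_of_eqvGen ha hb h with h | h
  · rcases h.cases_head with h | ⟨_, ⟨i, rfl, _⟩, _⟩
    · exact h
    · exact absurd ⟨i, rfl⟩ hx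
  · rcases h.cases_head with h | ⟨_, ⟨i, rfl, _⟩, _⟩
    · exact h.symm
    · exact absurd ⟨i, rfl⟩ hz

/-- The same for the first edge of a strand, which has no predecessor. -/
theorem eq_of_eqvGen_of_notMem_range_right (ha : Injective a) (hb : Injective b) {x z : E}
    (h : Relation.EqvGen (Junction a b) x z) (hx : x ∉ Set.range b) (hz : z ∉ Set.range b) :
    x = z := by
  rcases reflTransGen_or_of_eqvGen ha hb h with h | h
  · rcases h.cases_tail with h | ⟨_, _, ⟨i, _, rfl⟩⟩
    · exact h.symm
    · exact absurd ⟨i, rfl⟩ hz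
  · rcases h.cases_tail with h | ⟨_, _, ⟨i, _, rfl⟩⟩
    · exact h
    · exact absurd ⟨i, rfl⟩ hx

variable [Fintype E] {E' : Type} {y : E} {joined : E → E'} {l : E → ℕ} {l' : E' → ℕ}

/-- All edges joined to `x` start and end at junctions. -/
def IsClosedStrand (a b : Bool → E) (x : E) : Prop :=
  ∀ z, Relation.EqvGen (Junction a b) z x → z ∈ Set.range a ∧ z ∈ Set.range b

open Classical in
-- Each junction has exactly one incoming edge `a i`, so its copy of `l y` can be charged to that
-- edge. The label becomes a sum of crossing costs `l (a i) + l y`, plus the edges that enter no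
-- junction.
theorem label_joined (ha : Injective a) (hay : ∀ i, a i ≠ y)
    (hj : ∀ x z, x ≠ y → z ≠ y →
      (joined x = joined z ↔ Relation.EqvGen (Junction a b) x z))
    (hl : ∀ e', l' e' = (∑ x : E, if x ≠ y ∧ joined x = e' then l x else 0) +
      ∑ i : Bool, if joined (a i) = e' then l y else 0) {x : E} (hx : x ≠ y) :
    l' (joined x) = (∑ i : Bool, if Relation.EqvGen (Junction a b) (a i) x then l (a i) + l y else 0)
      + ∑ z : E, if z ∉ Set.range a ∧ z ≠ y ∧ Relation.EqvGen (Junction a b) z x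
        then l z else 0 := by
  have h1 : ∀ z, (z ≠ y ∧ joined z = joined x) ↔
      (z ≠ y ∧ Relation.EqvGen (Junction a b) z x) := fun z =>
    and_congr_right fun hz => hj z x hz hx
  have h2 : (∑ z : E, if z ≠ y ∧ joined z = joined x then l z else 0) =
      (∑ i : Bool, if Relation.EqvGen (Junction a b) (a i) x then l (a i) else 0) +
      ∑ z : E, if z ∉ Set.range a ∧ z ≠ y ∧ Relation.EqvGen (Junction a b) z x
        then l z else 0 := by
    have h3 : (∑ i : Bool, if Relation.EqvGen (Junction a b) (a i) x then l (a i) else 0) =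
        ∑ z ∈ Finset.univ.image a, if z ≠ y ∧ joined z = joined x then l z else 0 := by
      rw [Finset.sum_image fun i _ j _ h => ha h]
      refine Finset.sum_congr rfl fun i _ => ?_
      simp only [hay i, ne_eq, not_false_eq_true, true_and, hj _ _ (hay i) hx]
    rw [h3, ← Finset.sum_add_sum_compl (Finset.univ.image a)]
    congr 1
    rw [← Finset.sum_subset (Finset.subset_univ (Finset.univ.image a)ᶜ)]
    · refine Finset.sum_congr rfl fun z hz => ?_
      have : z ∉ Set.range a := by simpa [or_comm, and_comm] using hz
      simp only [h1, this, not_false_eq_true, true_and]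
    · intro z _ hz
      have : z ∈ Set.range a := by simpa [or_comm, or_iff_not_imp_right] using hz
      rw [if_neg fun h => h.1 this]
  rw [hl, h2, add_right_comm, ← Finset.sum_add_distrib]
  congr 1
  refine Finset.sum_congr rfl fun i _ => ?_
  simp only [hj _ _ (hay i) hx]
  split_ifs <;> simp

/-- The position of every edge on its strand after joining: `o x` is the sum of the labels before
`x`. -/
theorem exists_offset (ha : Injective a) (hb : Injective b) (hay : ∀ i, a i ≠ y)
    (hby : ∀ i, b i ≠ y)
    (hj : ∀ x z, x ≠ y → z ≠ y →
      (joined x = joined z ↔ Relation.EqvGen (Junction a b) x z))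
    (hl : ∀ e', l' e' = (∑ x : E, by classical exact if x ≠ y ∧ joined x = e' then l x else 0) +
      ∑ i : Bool, by classical exact if joined (a i) = e' then l y else 0) :
    ∃ o : E → ℤ,
      (∀ i, o (b i) = o (a i) + (l (a i) + l y) ∨
        IsClosedStrand a b (a i) ∧ o (b i) = o (a i) + (l (a i) + l y) - l' (joined (a i))) ∧
      (∀ x, x ≠ y → x ∉ Set.range a → (l' (joined x) : ℤ) = o x + l x) ∧
      (∀ x, x ≠ y → x ∉ Set.range b → o x = 0) ∧
      (∀ i (n : ℤ), IsClosedStrand a b (b i) →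
        Relation.EqvGen (fun p q : E × ℤ => ∃ i, p.1 = a i ∧ q.1 = b i ∧
          q.2 = p.2 - (l (a i) + l y)) (b i, n) (b i, n - l' (joined (b i)))) := by
  -- Offsets add up the crossing costs from the first edge of a strand. A closed strand has no first
  -- edge: it is cut at one junction, where the offset drops by the full label, and the last clause
  -- says that one turn around it takes that label as time.
  classical
  have hL := fun {x} hx => label_joined (x := x) ha hay hj (by convert hl) hx
  -- A strand that has a last edge `x` contains no other edge outside the range of `a`.
  have hL1 : ∀ x, x ≠ y → x ∉ Set.range a → l' (joined x) =
      (∑ i : Bool, if Relation.EqvGen (Junction a b) (a i) x then l (a i) + l y else 0)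
        + l x := by
    intro x hx hxa
    rw [hL hx]
    congr 1
    rw [Finset.sum_eq_single x]
    · rw [if_pos ⟨hxa, hx, .refl _⟩]
    · intro z _ hzx
      rw [if_neg]
      rintro ⟨hz, _, h⟩
      exact hzx (eq_of_eqvGen_of_notMem_range_left ha hb h hz hxa)
    · simp
  have hL2 : ∀ x, x ≠ y → IsClosedStrand a b x → l' (joined x) =
      (∑ i : Bool, if Relation.EqvGen (Junction a b) (a i) x then l (a i) + l y else 0) := by
    intro x hx hc
    rw [hL hx, add_eq_left]
    refine Finset.sum_eq_zero fun z _ => if_neg ?_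
    rintro ⟨hz, _, h⟩
    exact hz (hc z h).1
  have hr : ∀ i, Relation.EqvGen (Junction a b) (a i) (b i) := fun i => .rel _ _ ⟨i, rfl, rfl⟩
  have hstep : ∀ i (n : ℤ), Relation.EqvGen (fun p q : E × ℤ => ∃ i, p.1 = a i ∧ q.1 = b i ∧
          q.2 = p.2 - (l (a i) + l y)) (a i, n) (b i, n - (l (a i) + l y)) :=
    fun i n => .rel _ _ ⟨i, rfl, rfl, rfl⟩
  have hft : ∀ {c : Bool → E}, Injective c → c false ≠ c true := fun hc h => by
    simpa using hc h
  have haft := hft ha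
  by_cases hA : a false = b true ∧ a true = b false
  · -- the two strands close up to one circle
    obtain ⟨hA1, hA2⟩ := hA
    have hcl : ∀ x z, Relation.EqvGen (Junction a b) x z →
        (x = z ∨ (x ∈ Set.range a ∧ z ∈ Set.range a)) := by
      intro x z h
      induction h with
      | rel x z h =>
        obtain ⟨i, rfl, rfl⟩ := h
        refine Or.inr ⟨⟨i, rfl⟩, ⟨!i, ?_⟩⟩
        cases i <;> simp [hA1, hA2]
      | refl x => exact Or.inl rfl
      | symm x z _ ih => tauto
      | trans x t z _ _ ih₁ ih₂ => grind
    have hall : ∀ i j, Relation.EqvGen (Junction a b) (a i) (a j) := by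
      have : Relation.EqvGen (Junction a b) (a false) (a true) := hA2 ▸ hr false
      intro i j
      cases i <;> cases j
      exacts [.refl _, this, this.symm, .refl _]
    have hrange : ∀ i, a i ∈ Set.range b := by
      intro i; cases i
      exacts [⟨true, hA1.symm⟩, ⟨false, hA2.symm⟩]
    have hclosed : ∀ i, IsClosedStrand a b (a i) := by
      intro i z h
      rcases hcl _ _ h with rfl | ⟨⟨j, rfl⟩, -⟩
      · exact ⟨⟨i, rfl⟩, hrange i⟩
      · exact ⟨⟨j, rfl⟩, hrange j⟩
    have hlab : ∀ i, (l' (joined (a i)) : ℤ) =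
        (l (a false) + l y) + (l (a true) + l y) := by
      intro i
      rw [hL2 _ (hay i) (hclosed i)]
      simp [hall]
      ring
    -- The circle is cut just before `a false`, so the junction `true` is the one that closes it.
    refine ⟨fun x => if x = a true then l (a false) + l y else 0, ?_, ?_, ?_, ?_⟩
    · intro i
      cases i
      · left; simp [← hA2, haft]
      · right
        refine ⟨hclosed true, ?_⟩
        rw [hlab]
        simp [← hA1, haft]
    · intro x hx hxa
      have hxt : x ≠ a true := fun h => hxa ⟨true, h.symm⟩
      rw [hL1 x hx hxa, Finset.sum_eq_zero]
      · simp [hxt]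
      · intro i _
        rw [if_neg]
        intro h
        rcases hcl _ _ h with h | h
        · exact hxa ⟨i, h⟩
        · exact hxa h.2
    · intro x hx hxb
      refine if_neg ?_
      rintro rfl
      exact hxb ⟨false, hA2.symm⟩
    · intro i n _
      cases i
      · rw [← hA2, hlab]
        have h1 := hstep true n
        have h2 := hstep false (n - (l (a true) + l y))
        rw [← hA1] at h1
        rw [← hA2] at h2
        convert h1.trans _ _ _ h2 using 2
        ring
      · rw [← hA1, hlab]
        have h1 := hstep false n
        have h2 := hstep true (n - (l (a false) + l y))
        rw [← hA2] at h1
        rw [← hA1] at h2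
        convert h1.trans _ _ _ h2 using 2
        ring
  by_cases hB : ∃ i, a i = b !i
  · -- the two strands become one
    obtain ⟨i, hi⟩ := hB
    have hne : a (!i) ≠ b i := by
      intro h; cases i <;> simp_all
    have haa : a i ≠ a !i := fun h => by simpa using ha h
    have hbb : b i ≠ b !i := fun h => by simpa using hb h
    have hboth : ∀ j, j = i ∨ j = !i := by intro j; cases i <;> cases j <;> simp
    have hcl : ∀ x z, Relation.EqvGen (Junction a b) x z →
        (x = z ∨ ((x = a i ∨ x = a (!i) ∨ x = b i) ∧ (z = a i ∨ z = a (!i) ∨ z = b i))) := by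
      intro x z h
      induction h with
      | rel x z h =>
        obtain ⟨j, rfl, rfl⟩ := h
        rcases hboth j with rfl | rfl <;> simp [hi]
      | refl x => exact Or.inl rfl
      | symm x z _ ih => tauto
      | trans x t z _ _ ih₁ ih₂ => grind
    have h1 : Relation.EqvGen (Junction a b) (a !i) (a i) := hi ▸ hr (!i)
    have h2 : Relation.EqvGen (Junction a b) (a !i) (b i) := h1.trans _ _ _ (hr i)
    have hsum : ∀ f : Bool → ℕ, ∑ j, f j = f i + f !i := by
      intro f; cases i <;> simp [add_comm]
    have hbi : b i ∉ Set.range a := by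
      rintro ⟨j, hj⟩
      rcases hboth j with rfl | rfl
      · exact hbb (hj.symm.trans hi)
      · exact hne hj
    have hopen : ∀ z, (z = a i ∨ z = a (!i) ∨ z = b i) → ¬ IsClosedStrand a b z := by
      intro z hz hc
      refine hbi (hc (b i) ?_).1
      rcases hz with rfl | rfl | rfl
      exacts [(hr i).symm, h2.symm, .refl _]
    -- The strand runs through `a !i`, then `b !i = a i`, then `b i`, with no, one and two junctions
    -- crossed before them.
    refine ⟨fun x => if x = b i then (l (a (!i)) + l y) + (l (a i) + l y) else
      if x = a i then l (a (!i)) + l y else 0, ?_, ?_, ?_, ?_⟩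
    · intro j
      left
      have hab : a i ≠ b i := fun h => hbb (h.symm.trans hi)
      rcases hboth j with rfl | rfl
      · simp [hab]
      · simp [← hi, hab, hne, haa.symm]
    · intro x hx hxa
      rw [hL1 x hx hxa, hsum]
      by_cases hxb : x = b i
      · subst hxb
        simp only [hr i, h2, if_true]
        push_cast
        ring
      · have hn : ∀ j, ¬ Relation.EqvGen (Junction a b) (a j) x := by
          intro j h
          rcases hcl _ _ h with h | ⟨-, h⟩
          · exact hxa ⟨j, h⟩
          · rcases h with rfl | rfl | rfl
            exacts [hxa ⟨_, rfl⟩, hxa ⟨_, rfl⟩, hxb rfl]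
        have : x ≠ a i := fun h => hxa ⟨i, h.symm⟩
        simp [hn, hxb, this]
    · intro x hx hxb
      have h1 : x ≠ b i := fun h => hxb ⟨i, h.symm⟩
      have h2 : x ≠ a i := fun h => hxb ⟨!i, (h.trans hi).symm⟩
      simp [h1, h2]
    · intro j n hc
      refine absurd hc (hopen _ ?_)
      rcases hboth j with rfl | rfl <;> simp [hi]
  · -- the strands stay separate
    have hne : ∀ i, a i ≠ b !i := by simpa using hB
    have hne' : ∀ i j, a i = b j → i = j := by
      intro i j h
      by_contra hij
      have : j = !i := by cases i <;> cases j <;> simp_all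
      exact hne i (this ▸ h)
    have hcl : ∀ x z, Relation.EqvGen (Junction a b) x z →
        (x = z ∨ ∃ i, (x = a i ∨ x = b i) ∧ (z = a i ∨ z = b i)) := by
      intro x z h
      induction h with
      | rel x z h =>
        obtain ⟨j, rfl, rfl⟩ := h
        exact Or.inr ⟨j, by simp⟩
      | refl x => exact Or.inl rfl
      | symm x z _ ih => grind
      | trans x t z _ _ ih₁ ih₂ =>
        rcases ih₁ with rfl | ⟨i, h1, h2⟩
        · exact ih₂
        rcases ih₂ with rfl | ⟨j, h3, h4⟩
        · exact Or.inr ⟨i, h1, h2⟩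
        have : i = j := by
          rcases h2 with rfl | rfl <;> rcases h3 with h3 | h3
          exacts [ha h3, hne' _ _ h3, (hne' _ _ h3.symm).symm, hb h3]
        subst this
        exact Or.inr ⟨i, h1, h4⟩
    have hiff : ∀ i j, Relation.EqvGen (Junction a b) (a i) (b j) ↔ i = j := by
      refine fun i j => ⟨fun h => ?_, fun h => h ▸ hr i⟩
      rcases hcl _ _ h with h | ⟨k, h | h, h' | h'⟩
      · exact hne' _ _ h
      · rw [ha h, hne' _ _ h'.symm]
      · rw [ha h, hb h']
      · rw [hne' _ _ h, hne' _ _ h'.symm]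
      · rw [hne' _ _ h, hb h']
    have hloop : ∀ i, a i = b i → IsClosedStrand a b (b i) := by
      intro i h z hz
      have : z = b i := by
        rcases hcl _ _ hz with h' | ⟨k, h' | h', h'' | h''⟩
        · exact h'
        · rw [h', ← h'']
        · rw [h', ← hb h'', h]
        · rw [h', ha (h.trans h'')]
        · rw [h', h'']
      subst this
      exact ⟨⟨i, h⟩, ⟨i, rfl⟩⟩
    have hlab : ∀ i, IsClosedStrand a b (b i) → l' (joined (b i)) = l (a i) + l y := by
      intro i hc
      rw [hL2 _ (hby i) hc]
      simp [hiff]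
    have hsum : ∀ (f : Bool → ℤ) i, (∀ j, f j ≠ 0 → j = i) → ∑ j, f j = f i := by
      intro f i h
      exact Finset.sum_eq_single i (fun j _ hj => by_contra fun h' => hj (h j h')) (by simp)
    have hob : ∀ i, (∑ j : Bool, if b i = b j ∧ a j ≠ b j then ((l (a j) + l y : ℕ) : ℤ) else 0)
        = if a i ≠ b i then ((l (a i) + l y : ℕ) : ℤ) else 0 := by
      intro i
      rw [hsum _ i]
      · simp
      · intro j hj
        by_contra h
        exact hj (if_neg fun h' => h (hb h'.1).symm)
    have hoa : ∀ x, x ∉ Set.range b →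
        (∑ j : Bool, if x = b j ∧ a j ≠ b j then ((l (a j) + l y : ℕ) : ℤ) else 0) = 0 := by
      intro x hx
      refine Finset.sum_eq_zero fun j _ => if_neg fun h => hx ⟨j, h.1.symm⟩
    -- Only the far end of a junction can have a non-zero offset. If `a j = b j`, the strand is a
    -- one-edge circle and the offset is set to zero there.
    refine ⟨fun x => ∑ j : Bool, if x = b j ∧ a j ≠ b j then ((l (a j) + l y : ℕ) : ℤ) else 0,
      ?_, ?_, ?_, ?_⟩
    · intro i
      by_cases h : a i = b i
      · right
        have := hloop i h
        refine ⟨h ▸ this, ?_⟩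
        have h' : l' (joined (a i)) = l (a i) + l y := by rw [← hlab i this, h]
        rw [h', h]
        push_cast
        ring
      · left
        beta_reduce
        rw [hob, hoa (a i), if_pos h]
        · push_cast; ring
        · rintro ⟨j, hj⟩
          have := hne' _ _ hj.symm
          subst this
          exact h hj.symm
    · intro x hx hxa
      beta_reduce
      rw [hL1 x hx hxa]
      by_cases hxb : x ∈ Set.range b
      · obtain ⟨i, rfl⟩ := hxb
        rw [hob, if_pos (fun h => hxa ⟨i, h⟩)]
        simp [hiff]
      · rw [hoa x hxb, Finset.sum_eq_zero]
        · simp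
        · intro i _
          rw [if_neg]
          intro h
          rcases hcl _ _ h with h | ⟨k, -, h | h⟩
          exacts [hxa ⟨_, h⟩, hxa ⟨_, h.symm⟩, hxb ⟨_, h.symm⟩]
    · intro x _ hxb
      exact hoa x hxb
    · intro i n hc
      rw [hlab i hc]
      have h : a i = b i := by
        obtain ⟨j, hj⟩ := (hc (b i) (.refl _)).1
        rw [← hne' _ _ hj, hj, hne' _ _ hj]
      have := hstep i n
      rw [h] at this
      push_cast
      rw [h]
      exact this

end Junctions

/-! ### Invariance of models under Rule I. -/

theorem Equiv.Perm.SameCycle.rec_equivalence {α : Type*} {f : Equiv.Perm α} {R : α → α → Prop}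
    (hR : Equivalence R) (h : ∀ p, R p (f p)) {p q : α} (hpq : f.SameCycle p q) : R p q := by
  obtain ⟨k, rfl⟩ := hpq
  induction k with
  | zero => exact hR.refl p
  | succ k ih =>
    refine hR.trans ih ?_
    rw [add_comm, zpow_add, zpow_one]
    exact h _
  | pred k ih =>
    refine hR.trans ih (hR.symm ?_)
    have := h ((f ^ (-(k : ℤ) - 1)) p)
    rwa [← Equiv.Perm.mul_apply, ← zpow_one_add, add_sub_cancel] at this

namespace CylinderDiagram

/-- A word entering the removed merge on side `i` receives the letter `i`, loses it at the split and
leaves on side `i`: the word is unchanged and the time `l (a i) + l y` has passed. The map `π` moves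
a point to the start of its new strand, correcting the clock by the offset. It induces a bijection
between the orbits of the two flows, so the old model composed with a section of `π` is a model. The
section keeps the word, hence also the local behaviour of `Ψ`. -/
theorem IsModel.exists_of_ruleI {D D' : CylinderDiagram} {g : Cantor ≃ₜ Cantor}
    {Ψ : D.FlowSpace → Cantor} (hΨ : D.IsModel g Ψ) (hDD' : RuleI D D') :
    ∃ Ψ' : D'.FlowSpace → Cantor, D'.IsModel g Ψ' := by
  classical
  obtain ⟨m, s, y, joined, kS, kM, ⟨hmy, hsy⟩, hsurj, hj, hinS, houtS, hinM, houtM, hl⟩ := hDD'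
  set a : Bool → D.Edge := fun i => D.inn (.inr (m, i))
  set b : Bool → D.Edge := fun i => D.out (.inl (s, i))
  have ha : Injective a := fun i j h => by simpa using D.inn_injective h
  have hb : Injective b := fun i j h => by simpa using D.out_injective h
  have hay : ∀ i, a i ≠ y := fun i h => by simpa using D.inn_injective (h.trans hsy.symm)
  have hby : ∀ i, b i ≠ y := fun i h => by simpa using D.out_injective (h.trans hmy.symm)
  replace hj : ∀ x z, x ≠ y → z ≠ y →
      (joined x = joined z ↔ Relation.EqvGen (Junction a b) x z) := hj
  obtain ⟨o, h1, h2, h3, h5⟩ := exists_offset (l := D.label) (l' := D'.label) ha hb hay hby hj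
    (by intro e'; rw [hl e'])
  -- the ports of the new diagram
  have hinS_y : ∀ t, D.inn (.inl (kS t).1) ≠ y := fun t h =>
    (kS t).2 (by simpa using D.inn_injective (h.trans hsy.symm))
  have hinM_y : ∀ n i, D.inn (.inr ((kM n).1, i)) ≠ y := fun n i h => by
    simpa using D.inn_injective (h.trans hsy.symm)
  have houtS_y : ∀ t i, D.out (.inl ((kS t).1, i)) ≠ y := fun t i h => by
    simpa using D.out_injective (h.trans hmy.symm)
  have houtM_y : ∀ n, D.out (.inr (kM n).1) ≠ y := fun n h =>
    (kM n).2 (by simpa using D.out_injective (h.trans hmy.symm))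
  have hinS_a : ∀ t, D.inn (.inl (kS t).1) ∉ Set.range a := by
    rintro t ⟨i, h⟩; simpa using D.inn_injective h
  have hinM_a : ∀ n i, D.inn (.inr ((kM n).1, i)) ∉ Set.range a := by
    rintro n i ⟨j, h⟩
    have := D.inn_injective h
    simp only [Sum.inr.injEq, Prod.mk.injEq] at this
    exact (kM n).2 this.1.symm
  have houtS_b : ∀ t i, D.out (.inl ((kS t).1, i)) ∉ Set.range b := by
    rintro t i ⟨j, h⟩
    have := D.out_injective h
    simp only [Sum.inl.injEq, Prod.mk.injEq] at this
    exact (kS t).2 this.1.symm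
  have houtM_b : ∀ n, D.out (.inr (kM n).1) ∉ Set.range b := by
    rintro n ⟨i, h⟩; simpa using D.out_injective h
  have hcirc_y : ∀ x, D.IsCircle x → x ≠ y := fun x hx h => hx ⟨_, hmy.trans h.symm⟩
  have hcirc_b : ∀ x, D.IsCircle x → x ∉ Set.range b := by
    rintro x hx ⟨i, rfl⟩; exact hx ⟨_, rfl⟩
  have hcirc_a : ∀ x, D.IsCircle x → x ∉ Set.range a := by
    rintro x hx ⟨i, rfl⟩
    exact hx (D.range_eq ▸ ⟨_, rfl⟩)
  -- A surviving output port is on no edge `b i`, so it could only begin a strand; neither an old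
  -- circle nor a closed strand has such a beginning.
  have hcircle' : ∀ x, x ≠ y → (D.IsCircle x ∨ IsClosedStrand a b x) → D'.IsCircle (joined x) := by
    have key : ∀ x z, x ≠ y → (D.IsCircle x ∨ IsClosedStrand a b x) → z ≠ y →
        z ∈ Set.range D.out → z ∉ Set.range b → joined z ≠ joined x := by
      intro x z hx hc hz hzo hzb h
      rw [hj z x hz hx] at h
      rcases hc with hc | hc
      · exact hc (eq_of_eqvGen_of_notMem_range_right ha hb h hzb (hcirc_b x hc) ▸ hzo)
      · exact hzb (hc z h).2
    rintro x hx hc ⟨⟨t, i⟩ | n, h⟩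
    · rw [houtS] at h
      exact key x _ hx hc (houtS_y t i) ⟨_, rfl⟩ (houtS_b t i) h
    · rw [houtM] at h
      exact key x _ hx hc (houtM_y n) ⟨_, rfl⟩ (houtM_b n) h
  -- the projection of the flow
  let π : D.FlowSpace → D'.FlowSpace := fun p =>
    -- A point on the removed edge is first taken back through the merge; its first letter tells the
    -- side.
    if p.1 = y then (joined (a (p.2.1 0)), p.2.1.tail, p.2.2 + D.label (a (p.2.1 0)) + o (a (p.2.1 0)))
    else (joined p.1, p.2.1, p.2.2 + o p.1)
  have hπy : ∀ w n, π (y, w, n) = (joined (a (w 0)), w.tail, n + D.label (a (w 0)) + o (a (w 0))) :=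
    fun w n => if_pos rfl
  have hπ : ∀ e w n, e ≠ y → π (e, w, n) = (joined e, w, n + o e) := fun e w n he => if_neg he
  have hflow_a : ∀ i w n, D.flow (a i, w, n) = (y, Cantor.cons i w, n - D.label (a i)) := by
    intro i w n
    rw [← hmy]; exact flow_merge m i w n
  have hflow_y : ∀ w n, D.flow (y, w, n) = (b (w 0), w.tail, n - D.label y) := by
    intro w n
    rw [← hsy]; exact flow_split s w n
  -- These are the edges that end a strand and the old circles: there the new label is offset plus
  -- old label, and the next edge has offset zero.
  have hstep : ∀ p : D.FlowSpace, ((∃ t, p.1 = D.inn (.inl (kS t).1)) ∨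
      (∃ n i, p.1 = D.inn (.inr ((kM n).1, i))) ∨ D.IsCircle p.1) →
      π (D.flow p) = D'.flow (π p) := by
    rintro ⟨e, w, n⟩ (⟨t, rfl⟩ | ⟨k, i, rfl⟩ | he)
    · rw [flow_split, hπ _ _ _ (houtS_y t _), hπ _ _ _ (hinS_y t), ← hinS, flow_split, houtS,
        h3 _ (houtS_y t _) (houtS_b t _), hinS, h2 _ (hinS_y t) (hinS_a t)]
      congr 2; ring
    · rw [flow_merge, hπ _ _ _ (houtM_y k), hπ _ _ _ (hinM_y k i), ← hinM, flow_merge, houtM,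
        h3 _ (houtM_y k) (houtM_b k), hinM, h2 _ (hinM_y k i) (hinM_a k i)]
      congr 2; ring
    · have hey := hcirc_y e he
      rw [flow_circle he, hπ _ _ _ hey, hπ _ _ _ hey, flow_circle (hcircle' e hey (Or.inl he)),
        h2 _ hey (hcirc_a e he), h3 _ hey (hcirc_b e he)]
      congr 2; ring
  -- Inside the removed pair `π` does not change, except at the cut of a closed strand, where it
  -- makes one turn of the new circle.
  have hstep' : ∀ p, D'.flow.SameCycle (π p) (π (D.flow p)) := by
    rintro ⟨e, w, n⟩
    have good : ∀ p : D.FlowSpace, π (D.flow p) = D'.flow (π p) →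
        D'.flow.SameCycle (π p) (π (D.flow p)) := fun p h => by
      rw [h]; exact ⟨1, rfl⟩
    rcases edge_cases_inn e with ⟨t, rfl⟩ | ⟨k, i, rfl⟩ | he
    · by_cases ht : t = s
      · subst ht
        rw [hsy, hflow_y, hπy, hπ _ _ _ (hby _),
          ← (hj _ _ (hay _) (hby _)).2 (.rel _ _ ⟨w 0, rfl, rfl⟩)]
        rcases h1 (w 0) with h | ⟨hc, h⟩
        · rw [h]
          convert Equiv.Perm.SameCycle.refl _ _ using 3
          ring
        · refine ⟨1, ?_⟩
          rw [zpow_one, flow_circle (hcircle' _ (hay _) (Or.inr hc)), h]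
          congr 2; ring
      · exact good _ (hstep _ (Or.inl ⟨kS.symm ⟨t, ht⟩, by simp⟩))
    · by_cases hk : k = m
      · subst hk
        change D'.flow.SameCycle (π (a i, w, n)) (π (D.flow (a i, w, n)))
        rw [hflow_a, hπy, hπ _ _ _ (hay i)]
        simp only [Cantor.cons_zero, Cantor.tail_cons, sub_add_cancel]
        exact Equiv.Perm.SameCycle.refl _ _
      · exact good _ (hstep _ (Or.inr (Or.inl ⟨kM.symm ⟨k, hk⟩, i, by simp⟩)))
    · exact good _ (hstep _ (Or.inr (Or.inr he)))
  have hforward : ∀ {p q}, D.flow.SameCycle p q → D'.flow.SameCycle (π p) (π q) := by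
    intro p q h
    refine Equiv.Perm.SameCycle.rec_equivalence (R := fun p q => D'.flow.SameCycle (π p) (π q))
      ⟨fun _ => .refl _ _, fun h => h.symm, fun h h' => h.trans h'⟩ hstep' h
  -- points with the same projection lie on the same orbit
  have hjump : ∀ i w n, D.flow.SameCycle (a i, w, n) (b i, w, n - (D.label (a i) + D.label y)) := by
    intro i w n
    refine ⟨2, ?_⟩
    change D.flow (D.flow (a i, w, n)) = _
    rw [hflow_a, hflow_y]
    simp only [Cantor.cons_zero, Cantor.tail_cons, sub_sub]
  have hclosed : ∀ i w n, IsClosedStrand a b (b i) →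
      D.flow.SameCycle (b i, w, n) (b i, w, n - D'.label (joined (b i))) := by
    intro i w n hc
    have key : ∀ {p q : D.Edge × ℤ}, Relation.EqvGen (fun p q : D.Edge × ℤ => ∃ i, p.1 = a i ∧
        q.1 = b i ∧ q.2 = p.2 - (D.label (a i) + D.label y)) p q →
        D.flow.SameCycle (p.1, w, p.2) (q.1, w, q.2) := by
      intro p q h
      induction h with
      | rel p q h =>
        obtain ⟨i, h, h', h''⟩ := h
        rw [h, h', h'']; exact hjump i w _
      | refl p => exact .refl _ _
      | symm p q _ ih => exact ih.symm
      | trans p r q _ _ ih₁ ih₂ => exact ih₁.trans ih₂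
    exact key (h5 i n hc)
  -- With the offset subtracted, the points on all edges of a strand have the same projection.
  have hstrand : ∀ {x z}, Relation.EqvGen (Junction a b) x z → ∀ w n,
      D.flow.SameCycle (x, w, n - o x) (z, w, n - o z) := by
    intro x z h w n
    induction h with
    | rel x z h =>
      obtain ⟨i, rfl, rfl⟩ := h
      have hr : Relation.EqvGen (Junction a b) (a i) (b i) := .rel _ _ ⟨i, rfl, rfl⟩
      refine (hjump i w _).trans ?_
      rcases h1 i with h | ⟨hc, h⟩
      · rw [h]
        convert Equiv.Perm.SameCycle.refl _ _ using 3
        ring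
      · rw [(hj _ _ (hay _) (hby _)).2 hr] at h
        have := hclosed i w (n - o (b i)) fun z hz => hc z (hz.trans _ _ _ hr.symm)
        convert this.symm using 3
        rw [h]; ring
    | refl x => exact .refl _ _
    | symm x z _ ih => exact ih.symm
    | trans x t z _ _ ih₁ ih₂ => exact ih₁.trans ih₂
  have hrep : ∀ p, ∃ q : D.FlowSpace, q.1 ≠ y ∧ π q = π p ∧ D.flow.SameCycle p q := by
    rintro ⟨e, w, n⟩
    by_cases he : e = y
    · subst he
      refine ⟨(a (w 0), w.tail, n + D.label (a (w 0))), hay _, ?_, Equiv.Perm.SameCycle.symm ⟨1, ?_⟩⟩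
      · rw [hπy, hπ _ _ _ (hay _)]
      · rw [zpow_one, hflow_a]; simp
    · exact ⟨_, he, rfl, .refl _ _⟩
  have hfibre : ∀ {p q}, π p = π q → D.flow.SameCycle p q := by
    intro p q h
    obtain ⟨⟨e, w, n⟩, he, hp, hp'⟩ := hrep p
    obtain ⟨⟨e', w', n'⟩, he', hq, hq'⟩ := hrep q
    refine hp'.trans (Equiv.Perm.SameCycle.trans ?_ hq'.symm)
    rw [← hp, ← hq, hπ _ _ _ he, hπ _ _ _ he'] at h
    simp only [Prod.mk.injEq] at h
    obtain ⟨h, rfl, hn⟩ := h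
    have := hstrand ((hj _ _ he he').1 h) w (n + o e)
    rw [add_sub_cancel_right, hn, add_sub_cancel_right] at this
    exact this
  -- a section of the projection
  choose A hAy hA using hsurj
  let σ : D'.FlowSpace → D.FlowSpace := fun p => (A p.1, p.2.1, p.2.2 - o (A p.1))
  have hπσ : ∀ p, π (σ p) = p := by
    rintro ⟨e, w, n⟩
    change π (A e, w, n - o (A e)) = _
    rw [hπ _ _ _ (hAy e), hA, sub_add_cancel]
  -- A step of the new flow lifts to one step of the old flow, except on a new circle that contains
  -- no old one. Such a circle comes from a closed strand, and its step lifts to a whole turn.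
  have hlift : ∀ p, ∃ q r, π q = p ∧ π r = D'.flow p ∧ D.flow.SameCycle q r := by
    rintro ⟨e', w, n⟩
    have good : ∀ x, x ≠ y → joined x = e' → ((∃ t, x = D.inn (.inl (kS t).1)) ∨
      (∃ n i, x = D.inn (.inr ((kM n).1, i))) ∨ D.IsCircle x) →
      ∃ q r, π q = (e', w, n) ∧ π r = D'.flow (e', w, n) ∧ D.flow.SameCycle q r := by
      rintro x hx rfl hc
      have : π (x, w, n - o x) = (joined x, w, n) := by rw [hπ _ _ _ hx, sub_add_cancel]
      exact ⟨(x, w, n - o x), D.flow (x, w, n - o x), this, by rw [hstep _ hc, this], ⟨1, rfl⟩⟩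
    rcases edge_cases_inn e' with ⟨t, rfl⟩ | ⟨k, i, rfl⟩ | he
    · exact good _ (hinS_y t) (hinS t).symm (Or.inl ⟨t, rfl⟩)
    · exact good _ (hinM_y k i) (hinM k i).symm (Or.inr (Or.inl ⟨k, i, rfl⟩))
    · by_cases hz : ∃ z, z ≠ y ∧ joined z = e' ∧ D.IsCircle z
      · obtain ⟨z, hzy, hz, hzc⟩ := hz
        exact good z hzy hz (Or.inr (Or.inr hzc))
      · have hEy : ∀ z x, x ≠ y → Relation.EqvGen (Junction a b) z x → z ≠ y := by
          have key : ∀ z x, Relation.EqvGen (Junction a b) z x → (z = y ↔ x = y) := by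
            intro z x h
            induction h with
            | rel x z h =>
              obtain ⟨i, rfl, rfl⟩ := h
              simp [hay, hby]
            | refl x => rfl
            | symm x z _ ih => exact ih.symm
            | trans x t z _ _ ih₁ ih₂ => exact ih₁.trans ih₂
          exact fun z x hx h hz => hx ((key z x h).1 hz)
        have hcl : IsClosedStrand a b (A e') := by
          intro z hz'
          have hzy := hEy z _ (hAy e') hz'
          have hze : joined z = e' := ((hj _ _ hzy (hAy e')).2 hz').trans (hA e')
          have hzc : ¬ D.IsCircle z := fun h => hz ⟨z, hzy, hze, h⟩
          constructor
          · rcases edge_cases_inn z with ⟨t, rfl⟩ | ⟨k, i, rfl⟩ | h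
            · have ht : t ≠ s := by rintro rfl; exact hzy hsy
              refine absurd ⟨.inl (kS.symm ⟨t, ht⟩), ?_⟩ (D'.range_eq ▸ he : e' ∉ Set.range D'.inn)
              rw [hinS, ← hze]; simp
            · by_cases hk : k = m
              · subst hk; exact ⟨i, rfl⟩
              refine absurd ⟨.inr (kM.symm ⟨k, hk⟩, i), ?_⟩
                (D'.range_eq ▸ he : e' ∉ Set.range D'.inn)
              rw [hinM, ← hze]; simp
            · exact absurd h hzc
          · rcases edge_cases_out z with ⟨t, i, rfl⟩ | ⟨k, rfl⟩ | h
            · by_cases ht : t = s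
              · subst ht; exact ⟨i, rfl⟩
              refine absurd ⟨.inl (kS.symm ⟨t, ht⟩, i), ?_⟩ he
              rw [houtS, ← hze]; simp
            · have hk : k ≠ m := by rintro rfl; exact hzy hmy
              refine absurd ⟨.inr (kM.symm ⟨k, hk⟩), ?_⟩ he
              rw [houtM, ← hze]; simp
            · exact absurd h hzc
        obtain ⟨i, hi⟩ := (hcl (A e') (.refl _)).2
        refine ⟨σ (e', w, n), σ (e', w, n - D'.label e'), hπσ _, ?_, ?_⟩
        · rw [hπσ, flow_circle he]
        · have := hclosed i w (n - o (A e')) (hi ▸ hcl)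
          rw [hi, hA] at this
          convert this using 3
          ring
  -- The relation quantifies over all lifts of the two points. It is reflexive by `hfibre`, and
  -- transitive because `σ` supplies a lift of the middle point.
  have hbackward : ∀ {p q}, D'.flow.SameCycle (π p) (π q) → D.flow.SameCycle p q := by
    intro p q h
    refine Equiv.Perm.SameCycle.rec_equivalence
      (R := fun p' q' => ∀ p q, π p = p' → π q = q' → D.flow.SameCycle p q)
      ⟨?_, ?_, ?_⟩ ?_ h p q rfl rfl
    · intro _ p q hp hq; exact hfibre (hp.trans hq.symm)
    · intro _ _ h p q hp hq; exact (h q p hq hp).symm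
    · intro _ r _ h h' p q hp hq
      exact (h p (σ r) hp (hπσ r)).trans (h' (σ r) q (hπσ r) hq)
    · intro p' p q hp hq
      obtain ⟨p₁, q₁, hp₁, hq₁, h₁⟩ := hlift p'
      exact (hfibre (hp.trans hp₁.symm)).trans (h₁.trans (hfibre (hq₁.trans hq.symm)))
  -- Joining never lowers a label, so an orbit that meets a positive label still does so afterwards.
  have hlab : ∀ x, x ≠ y → D.label x ≤ D'.label (joined x) := by
    intro x hx
    rw [hl]
    refine le_add_right ?_
    refine le_trans ?_ (Finset.single_le_sum (fun _ _ => Nat.zero_le _) (Finset.mem_univ x))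
    rw [if_pos ⟨hx, rfl⟩]
  have hlaby : ∀ i, D.label y ≤ D'.label (joined (a i)) := by
    intro i
    rw [hl]
    refine le_add_left ?_
    refine le_trans ?_ (Finset.single_le_sum (fun _ _ => Nat.zero_le _) (Finset.mem_univ i))
    rw [if_pos rfl]
  refine ⟨Ψ ∘ σ, ?_, ?_, ?_, ?_, ?_⟩
  · intro e w n
    change Ψ (A e, w, n + 1 - o (A e)) = g (Ψ (A e, w, n - o (A e)))
    rw [← hΨ.shift]; congr 3; ring
  · intro c
    obtain ⟨p, rfl⟩ := hΨ.surjective c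
    exact ⟨π p, (hΨ.eq_iff _ _).2 (hfibre (hπσ _))⟩
  · intro p q
    rw [comp_apply, comp_apply, hΨ.eq_iff]
    constructor
    · intro h
      have := hforward h
      rwa [hπσ, hπσ] at this
    · intro h
      refine hbackward ?_
      rwa [hπσ, hπσ]
  · intro e w n
    exact hΨ.map_nhds (A e) w (n - o (A e))
  · intro p
    obtain ⟨⟨e, w, n⟩, h, hq⟩ := hΨ.pos (σ p)
    have h' := hforward h
    rw [hπσ] at h'
    refine ⟨_, h', ?_⟩
    by_cases he : e = y
    · subst he
      rw [hπy]
      exact hq.trans_le (hlaby _)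
    · rw [hπ _ _ _ he]
      exact hq.trans_le (hlab _ he)

end CylinderDiagram

/-! ### The model of a strand diagram on the cylinder. -/

namespace StrandDiagram

variable (P : StrandDiagram)

/-- A word crosses one caret of the diagram. -/
abbrev Step : P.Edge × Cantor → P.Edge × Cantor → Prop :=
  Travel (fun o => P.out (some o)) (fun i => P.inn (some i))

variable {P}

theorem Step.rightUnique : Relator.RightUnique P.Step := by
  have hi : Injective fun i => P.inn (some i) := P.inn_bijective.1.comp (Option.some_injective _)
  have key : ∀ p q q', P.Step p q → P.Step p q' → q = q' := by
    intro p q q' h h'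
    cases h with
    | split s b w =>
      generalize hp : ((P.inn (some (.inl s)), Cantor.cons b w) : P.Edge × Cantor) = p at h'
      cases h' with
      | split s' b' w' =>
        simp only [Prod.mk.injEq] at hp
        obtain ⟨h1, h2⟩ := hp
        obtain rfl : s = s' := by simpa using hi h1
        obtain rfl : b = b' := congrFun h2 0
        obtain rfl := Cantor.cons_injective _ h2
        rfl
      | merge m' b' w' =>
        simp only [Prod.mk.injEq] at hp
        simpa using hi hp.1
    | merge m b w =>
      generalize hp : ((P.inn (some (.inr (m, b))), w) : P.Edge × Cantor) = p at h'
      cases h' with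
      | split s' b' w' =>
        simp only [Prod.mk.injEq] at hp
        simpa using hi hp.1
      | merge m' b' w' =>
        simp only [Prod.mk.injEq] at hp
        obtain ⟨h1, rfl⟩ := hp
        have := hi h1
        simp only [Sum.inr.injEq, Prod.mk.injEq] at this
        obtain ⟨rfl, rfl⟩ := this
        rfl
  exact fun p q q' => key p q q'

theorem Step.fst_ne_sinkEdge {p q : P.Edge × Cantor} (h : P.Step p q) : p.1 ≠ P.sinkEdge := by
  cases h <;> exact P.inn_some_ne _

theorem Step.snd_ne_sourceEdge {p q : P.Edge × Cantor} (h : P.Step p q) :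
    q.1 ≠ P.sourceEdge := by
  cases h <;> exact P.out_some_ne _

theorem Step.follows {p q : P.Edge × Cantor} (h : P.Step p q) :
    Follows (fun o => P.out (some o)) (fun i => P.inn (some i)) p.1 q.1 := by
  cases h
  · exact .split _ _
  · exact .merge _ _

theorem exists_step {e : P.Edge} (he : e ≠ P.sinkEdge) (w : Cantor) : ∃ q, P.Step (e, w) q := by
  obtain ⟨s | ⟨m, b⟩, rfl⟩ := P.exists_inn he
  · rw [← Cantor.cons_tail w]
    exact ⟨_, .split s (w 0) w.tail⟩
  · exact ⟨_, .merge m b w⟩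

/-- On a finite acyclic diagram the relation of lying further downstream is well-founded, and a word
can move on from every edge but the sink edge. -/
theorem exists_arrival (p : P.Edge × Cantor) :
    ∃ c, Relation.ReflTransGen P.Step p (P.sinkEdge, c) := by
  let r : P.Edge → P.Edge → Prop := fun e e' =>
    Relation.TransGen (Follows (fun o => P.out (some o)) (fun i => P.inn (some i))) e' e
  have : Std.Irrefl r := ⟨P.acyclic⟩
  have : IsTrans P.Edge r := ⟨fun _ _ _ h h' => h'.trans h⟩
  have wf : WellFounded r := Finite.wellFounded_of_trans_of_irrefl r
  obtain ⟨e, w⟩ := p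
  induction e using wf.induction generalizing w with
  | h e ih =>
    by_cases he : e = P.sinkEdge
    · exact ⟨w, he ▸ .refl⟩
    · obtain ⟨⟨e', w'⟩, h⟩ := exists_step he w
      obtain ⟨c, hc⟩ := ih e' (.single h.follows) w'
      exact ⟨c, .head h hc⟩

/-- Travel is deterministic and no step leaves the sink edge. -/
theorem arrival_unique {p : P.Edge × Cantor} {c c' : Cantor}
    (h : Relation.ReflTransGen P.Step p (P.sinkEdge, c))
    (h' : Relation.ReflTransGen P.Step p (P.sinkEdge, c')) : c = c' := by
  rcases Relation.ReflTransGen.total_of_right_unique Step.rightUnique h h' with h | h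
  · rcases h.cases_head with h | ⟨_, h, _⟩
    · exact congrArg Prod.snd h
    · exact absurd rfl h.fst_ne_sinkEdge
  · rcases h.cases_head with h | ⟨_, h, _⟩
    · exact (congrArg Prod.snd h).symm
    · exact absurd rfl h.fst_ne_sinkEdge

/-- The word which arrives at the sink. -/
noncomputable def arrival (p : P.Edge × Cantor) : Cantor := (exists_arrival p).choose

theorem arrival_eq {p : P.Edge × Cantor} {c : Cantor}
    (h : Relation.ReflTransGen P.Step p (P.sinkEdge, c)) : arrival p = c :=
  arrival_unique (exists_arrival p).choose_spec h

theorem Step.arrival_eq {p q : P.Edge × Cantor} (h : P.Step p q) : arrival p = arrival q :=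
  StrandDiagram.arrival_eq (.head h (exists_arrival q).choose_spec)

theorem glue_of_mem (e : P.onCylinder.Edge) : P.glue e.1 = e := by
  obtain ⟨e, he⟩ := e
  unfold glue
  split_ifs with h
  · subst h
    rcases he with he | he
    · exact Subtype.ext he.symm
    · exact absurd rfl he
  · rfl

theorem glue_sinkEdge : P.glue P.sinkEdge = P.glue P.sourceEdge :=
  (P.glue_eq_iff _ _).2 (Or.inr (Or.inr ⟨rfl, rfl⟩))

theorem val_glue {e : P.Edge} (he : e ≠ P.sinkEdge) : (P.glue e).1 = e := by
  simp [glue, he]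

theorem val_glue_sourceEdge : (P.glue P.sourceEdge).1 = P.sourceEdge := by
  unfold glue
  split_ifs <;> rfl

theorem label_glue_sourceEdge : P.onCylinder.label (P.glue P.sourceEdge) = 1 :=
  if_pos val_glue_sourceEdge

theorem label_glue {e : P.Edge} (he : e ≠ P.sinkEdge) (he' : e ≠ P.sourceEdge) :
    P.onCylinder.label (P.glue e) = 0 :=
  if_neg (by rwa [val_glue he])

theorem flow_glue {p q : P.Edge × Cantor} (h : P.Step p q) (n : ℤ) :
    P.onCylinder.flow (P.glue p.1, p.2, n) =
      (P.glue q.1, q.2, n - P.onCylinder.label (P.glue p.1)) := by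
  cases h with
  | split s b w => exact CylinderDiagram.flow_split (D := P.onCylinder) s _ n
  | merge m b w => exact CylinderDiagram.flow_merge (D := P.onCylinder) m b w n

/-- All labels before the seam are zero, so the clock stands still on the way there. -/
theorem sameCycle_arrival {e : P.Edge} (he : e ≠ P.sourceEdge) (w : Cantor) (n : ℤ) :
    P.onCylinder.flow.SameCycle (P.glue e, w, n) (P.glue P.sourceEdge, arrival (e, w), n) := by
  have key : ∀ (p : P.Edge × Cantor) c, Relation.ReflTransGen P.Step p (P.sinkEdge, c) →
      p.1 ≠ P.sourceEdge →
      P.onCylinder.flow.SameCycle (P.glue p.1, p.2, n) (P.glue P.sourceEdge, c, n) := by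
    intro p c h
    induction h using Relation.ReflTransGen.head_induction_on with
    | refl => intro _; rw [glue_sinkEdge]
    | head h _ ih =>
      intro hp
      refine Equiv.Perm.SameCycle.trans ⟨1, ?_⟩ (ih h.snd_ne_sourceEdge)
      rw [zpow_one, flow_glue h, label_glue h.fst_ne_sinkEdge hp, Nat.cast_zero, sub_zero]
      rfl
  exact key (e, w) _ (exists_arrival _).choose_spec he

theorem isCircle_of_sourceEdge_eq (h : P.sourceEdge = P.sinkEdge) :
    P.onCylinder.IsCircle (P.glue P.sourceEdge) := by
  rintro ⟨o, ho⟩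
  rcases (P.glue_eq_iff _ _).1 ho with h' | h' | h'
  · exact P.out_some_ne o h'
  · exact P.out_some_ne o h'.1
  · exact P.out_some_ne o (h'.1.trans h.symm)

theorem sourceEdge_eq_of_isCircle {e : P.onCylinder.Edge} (he : P.onCylinder.IsCircle e) :
    e = P.glue P.sourceEdge ∧ P.sourceEdge = P.sinkEdge := by
  have h1 : e.1 = P.sourceEdge := by
    by_contra h
    obtain ⟨o, ho⟩ := P.exists_out h
    exact he ⟨o, by rw [← glue_of_mem e, ← ho]; rfl⟩
  have h2 : e = P.glue P.sourceEdge := by rw [← h1, glue_of_mem]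
  refine ⟨h2, ?_⟩
  by_contra h
  obtain ⟨i, hi⟩ := P.exists_inn h
  rw [CylinderDiagram.IsCircle, P.onCylinder.range_eq] at he
  exact he ⟨i, by rw [h2, ← hi]; rfl⟩

variable {g : Cantor ≃ₜ Cantor}

theorem Represents.arrival_sourceEdge (hP : P.Represents g) (w : Cantor) :
    arrival (P.sourceEdge, w) = g w := arrival_eq (hP w)

theorem arrival_sinkEdge (w : Cantor) : arrival (P.sinkEdge, w) = w := arrival_eq .refl

/-- One turn around the cylinder leaves the seam edge once, at the cost of one unit of time, and
applies `g`. If the source edge is the sink edge, the seam is a circle and `g` fixes every word. -/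
theorem Represents.sameCycle_seam (hP : P.Represents g) (w : Cantor) (n : ℤ) :
    P.onCylinder.flow.SameCycle (P.glue P.sourceEdge, w, n)
      (P.glue P.sourceEdge, g w, n - 1) := by
  have h1 := label_glue_sourceEdge (P := P)
  by_cases h : P.sourceEdge = P.sinkEdge
  · refine ⟨1, ?_⟩
    rw [zpow_one, CylinderDiagram.flow_circle (isCircle_of_sourceEdge_eq h), h1,
      ← hP.arrival_sourceEdge, h, arrival_sinkEdge]
    rfl
  · obtain ⟨⟨e, w'⟩, hs⟩ := exists_step h w
    have h2 := sameCycle_arrival hs.snd_ne_sourceEdge w' (n - 1)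
    rw [← hs.arrival_eq, hP.arrival_sourceEdge] at h2
    refine Equiv.Perm.SameCycle.trans ⟨1, ?_⟩ h2
    rw [zpow_one]
    refine (flow_glue hs n).trans ?_
    rw [h1]
    rfl

theorem Represents.sameCycle_seam_zpow (hP : P.Represents g) (w : Cantor) (n k : ℤ) :
    P.onCylinder.flow.SameCycle (P.glue P.sourceEdge, w, n)
      (P.glue P.sourceEdge, (g ^ k) w, n - k) := by
  induction k with
  | zero => exact ⟨0, by simp⟩
  | succ k ih =>
    refine ih.trans ?_
    convert hP.sameCycle_seam _ _ using 2
    rw [add_comm, zpow_add, zpow_one, sub_sub, add_comm (1 : ℤ)]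
    rfl
  | pred k ih =>
    refine ih.trans (Equiv.Perm.SameCycle.symm ?_)
    convert hP.sameCycle_seam _ _ using 2
    rw [← Homeomorph.mul_apply, ← zpow_one_add, add_sub_cancel]
    congr 1
    ring

open Classical in
-- The point of `(e, w, n)` is `g ^ n` applied to the word that `w` becomes on arrival at the seam.
-- Every orbit contains exactly one triple `(seam, c, 0)`, and `c` is its image.
theorem Represents.exists_isModel (hP : P.Represents g) :
    ∃ Ψ : P.onCylinder.FlowSpace → Cantor, P.onCylinder.IsModel g Ψ := by
  let D := P.onCylinder
  let seam : D.Edge := P.glue P.sourceEdge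
  let Φ : D.Edge → Cantor → Cantor := fun e w =>
    if e.1 = P.sourceEdge then w else arrival (e.1, w)
  have hΦs : ∀ w, Φ seam w = w := fun w => if_pos val_glue_sourceEdge
  have hΦ : ∀ e w, e ≠ P.sourceEdge → Φ (P.glue e) w = arrival (e, w) := by
    intro e w he
    by_cases h : e = P.sinkEdge
    · rw [h, glue_sinkEdge, arrival_sinkEdge]; exact hΦs w
    · have := val_glue h
      simp only [Φ, this, if_neg he]
  let Ψ : D.FlowSpace → Cantor := fun p => (g ^ p.2.2) (Φ p.1 p.2.1)
  have hstep : ∀ p, Ψ p = Ψ (D.flow p) := by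
    rintro ⟨e, w, n⟩
    by_cases he : D.IsCircle e
    · obtain ⟨rfl, h⟩ := sourceEdge_eq_of_isCircle he
      rw [CylinderDiagram.flow_circle he, label_glue_sourceEdge]
      change (g ^ n) (Φ seam w) = (g ^ (n - 1)) (Φ seam w)
      rw [hΦs]
      have : g w = w := by rw [← hP.arrival_sourceEdge, h, arrival_sinkEdge]
      nth_rewrite 2 [← this]
      rw [← Homeomorph.mul_apply, ← zpow_add_one, sub_add_cancel]
    · have h1 : e.1 ≠ P.sinkEdge := by
        intro h
        refine he ?_
        rcases e.2 with h' | h'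
        · have := isCircle_of_sourceEdge_eq (h'.symm.trans h)
          rwa [← h', glue_of_mem] at this
        · exact absurd h h'
      obtain ⟨⟨e', w'⟩, hs⟩ := exists_step h1 w
      have hf := flow_glue hs n
      rw [glue_of_mem] at hf
      rw [hf]
      change (g ^ n) (Φ e w) = (g ^ (n - (D.label e : ℤ))) (Φ (P.glue e') w')
      rw [hΦ _ _ hs.snd_ne_sourceEdge, ← hs.arrival_eq]
      by_cases h : e.1 = P.sourceEdge
      · have h2 : e = seam := by rw [← glue_of_mem e, h]
        have h3 : D.label seam = 1 := label_glue_sourceEdge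
        rw [h, h2, hΦs, hP.arrival_sourceEdge, h3, Nat.cast_one, ← Homeomorph.mul_apply,
          ← zpow_add_one, sub_add_cancel]
      · have h2 : D.label e = 0 := by rw [← glue_of_mem e]; exact label_glue h1 h
        rw [h2]
        simp [Φ, h]
  have hinv : ∀ {p q}, D.flow.SameCycle p q → Ψ p = Ψ q := fun {p q} h =>
    h.rec_equivalence (R := fun p q => Ψ p = Ψ q) ⟨fun _ => rfl, Eq.symm, Eq.trans⟩ hstep
  have hΨs : ∀ c, Ψ (seam, c, 0) = c := fun c => by
    simp only [Ψ, hΦs, zpow_zero]; rfl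
  have hseam : ∀ p, D.flow.SameCycle p (seam, Ψ p, 0) := by
    have key : ∀ w n, D.flow.SameCycle (seam, w, n) (seam, (g ^ n) w, 0) := by
      intro w n
      simpa using hP.sameCycle_seam_zpow w n n
    have : ∀ p, ∃ c, D.flow.SameCycle p (seam, c, 0) := by
      rintro ⟨e, w, n⟩
      by_cases h : e.1 = P.sourceEdge
      · have h2 : e = seam := by rw [← glue_of_mem e, h]
        subst h2
        exact ⟨_, key w n⟩
      · have := sameCycle_arrival h w n
        rw [glue_of_mem] at this
        exact ⟨_, this.trans (key _ _)⟩
    intro p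
    obtain ⟨c, hc⟩ := this p
    rwa [hinv hc, hΨs]
  refine ⟨Ψ, ?_, fun c => ⟨_, hΨs c⟩, ?_, ?_, ?_⟩
  · intro e w n
    change (g ^ (n + 1)) (Φ e w) = g ((g ^ n) (Φ e w))
    rw [add_comm, zpow_one_add]; rfl
  · refine fun p q => ⟨fun h => ?_, hinv⟩
    have := hseam p
    rw [h] at this
    exact this.trans (hseam q).symm
  -- Near `p`, one fixed power of the flow, a homeomorphism, leads into the slice of edge `seam` and
  -- time `0`, because edges and times are discrete. On this slice `Ψ` is the word coordinate.
  · have key : ∀ p, Filter.map Ψ (𝓝 p) = 𝓝 (Ψ p) := by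
      intro p
      obtain ⟨k, hk⟩ := hseam p
      rw [← CylinderDiagram.flowHomeo_zpow_apply] at hk
      have hev : Ψ =ᶠ[𝓝 p] fun q => ((D.flowHomeo ^ k) q).2.1 := by
        have h1 : ∀ᶠ q in 𝓝 p, ((D.flowHomeo ^ k) q).1 = seam ∧ ((D.flowHomeo ^ k) q).2.2 = 0 := by
          have hc := (D.flowHomeo ^ k).continuous
          have hc1 : Continuous fun q => ((D.flowHomeo ^ k) q).1 := continuous_fst.comp hc
          have hc2 : Continuous fun q => ((D.flowHomeo ^ k) q).2.2 :=
            continuous_snd.comp (continuous_snd.comp hc)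
          refine Filter.Eventually.and ?_ ?_
          · exact (hc1.isOpen_preimage {seam} (isOpen_discrete _)).mem_nhds (by simp [hk])
          · exact (hc2.isOpen_preimage {0} (isOpen_discrete _)).mem_nhds (by simp [hk])
        filter_upwards [h1] with q hq
        have h2 : Ψ q = Ψ ((D.flowHomeo ^ k) q) := by
          rw [CylinderDiagram.flowHomeo_zpow_apply]
          exact hinv ⟨k, rfl⟩
        have h3 : (D.flowHomeo ^ k) q = (seam, ((D.flowHomeo ^ k) q).2.1, 0) := by
          rw [← hq.1, ← hq.2]
        rw [h2, h3, hΨs]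
      rw [Filter.map_congr hev]
      change Filter.map ((Prod.fst ∘ Prod.snd) ∘ (D.flowHomeo ^ k)) (𝓝 p) = _
      rw [← Filter.map_map, (D.flowHomeo ^ k).map_nhds_eq, hk, ← Filter.map_map, map_snd_nhds,
        map_fst_nhds]
    intro e w n
    rw [← key, nhds_prod_eq, nhds_prod_eq, nhds_discrete D.Edge, nhds_discrete ℤ, Filter.prod_pure,
      Filter.pure_prod, Filter.map_map, Filter.map_map]
    rfl
  · intro p
    exact ⟨_, hseam p, by rw [label_glue_sourceEdge]; exact one_pos⟩

end StrandDiagram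

/-! ### Rule I applies and terminates. -/

/-- Every edge which does not end a junction is joined to one which does not start a junction. -/
theorem exists_eqvGen_notMem_range {E : Type} {a b : Bool → E} (ha : Injective a)
    (hb : Injective b) {x : E} (hx : x ∉ Set.range b) :
    ∃ z, Relation.EqvGen (Junction a b) x z ∧ z ∉ Set.range a ∧ (z = x ∨ z ∈ Set.range b) := by
  have hr : ∀ i, Relation.EqvGen (Junction a b) (a i) (b i) := fun i => .rel _ _ ⟨i, rfl, rfl⟩
  by_cases h1 : x ∈ Set.range a
  swap
  · exact ⟨x, .refl x, h1, Or.inl rfl⟩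
  obtain ⟨i, rfl⟩ := h1
  by_cases h2 : b i ∈ Set.range a
  swap
  · exact ⟨b i, hr i, h2, Or.inr ⟨i, rfl⟩⟩
  obtain ⟨j, hj⟩ := h2
  -- A strand with a first edge crosses each junction at most once; there are only two, so it has
  -- ended here.
  refine ⟨b j, (hr i).trans _ _ _ (hj ▸ hr j), ?_, Or.inr ⟨j, rfl⟩⟩
  rintro ⟨k, hk⟩
  have hki : k ≠ i := by rintro rfl; exact hx ⟨j, hk.symm⟩
  have hji : j ≠ i := by rintro rfl; exact hx ⟨j, hj.symm⟩
  have hkj : k = j := by cases i <;> cases j <;> cases k <;> simp_all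
  subst hkj
  exact hji (hb (hk.symm.trans hj))

theorem junction_eqvGen_flip {E : Type} {a b : Bool → E} {x z : E}
    (h : Relation.EqvGen (Junction b a) x z) : Relation.EqvGen (Junction a b) x z := by
  induction h with
  | rel x z h => exact .symm _ _ (.rel _ _ (Junction.flip_iff.1 h))
  | refl x => exact .refl x
  | symm x z _ ih => exact ih.symm
  | trans x t z _ _ ih₁ ih₂ => exact ih₁.trans _ _ _ ih₂

namespace CylinderDiagram

theorem RuleI.card_lt {D D' : CylinderDiagram} (h : RuleI D D') :
    Fintype.card D'.Merge < Fintype.card D.Merge := by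
  classical
  obtain ⟨m, s, y, joined, kS, kM, -⟩ := h
  rw [Fintype.card_congr kM]
  exact Fintype.card_subtype_lt (x := m) (by simp)

/-- The number of merges is a decreasing measure. -/
theorem acc_ruleI (D : CylinderDiagram) : Acc (fun D₂ D₁ => RuleI D₁ D₂) D :=
  Subrelation.accessible (fun h => RuleI.card_lt h)
    (InvImage.accessible (fun D : CylinderDiagram => Fintype.card D.Merge)
      (Nat.lt_wfRel.wf.apply _))

open Classical in
-- The new edges are the strands, that is, the classes of edges other than `y`. A strand has at most
-- one first and one last edge, so ports stay injective; if it has one of these it also has the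
-- other, so the ports of both kinds cover the same strands.
theorem exists_ruleI {D : CylinderDiagram} (hD : ¬ D.IsReduced) : ∃ D', RuleI D D' := by
  obtain ⟨m, s, y, hmy, hsy⟩ := not_not.1 hD
  set a : Bool → D.Edge := fun i => D.inn (.inr (m, i))
  set b : Bool → D.Edge := fun i => D.out (.inl (s, i))
  have ha : Injective a := fun i j h => by simpa using D.inn_injective h
  have hb : Injective b := fun i j h => by simpa using D.out_injective h
  have hay : ∀ i, a i ≠ y := fun i h => by simpa using D.inn_injective (h.trans hsy.symm)
  have hby : ∀ i, b i ≠ y := fun i h => by simpa using D.out_injective (h.trans hmy.symm)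
  let K : Setoid {x : D.Edge // x ≠ y} :=
    { r := fun x z => Relation.EqvGen (Junction a b) x.1 z.1
      iseqv := ⟨fun _ => .refl _, fun h => .symm _ _ h, fun h h' => .trans _ _ _ h h'⟩ }
  -- The class assigned to `y` is arbitrary.
  let joined : D.Edge → Quotient K := fun x =>
    if hx : x = y then ⟦⟨a false, hay _⟩⟧ else ⟦⟨x, hx⟩⟧
  have hjoined : ∀ x (hx : x ≠ y), joined x = ⟦⟨x, hx⟩⟧ := fun x hx => dif_neg hx
  have hj : ∀ x z, x ≠ y → z ≠ y →
      (joined x = joined z ↔ Relation.EqvGen (Junction a b) x z) := by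
    intro x z hx hz
    rw [hjoined x hx, hjoined z hz]
    exact Quotient.eq
  let out : OutPort {t : D.Split // t ≠ s} {n : D.Merge // n ≠ m} → OutPort D.Split D.Merge :=
    Sum.map (Prod.map Subtype.val id) Subtype.val
  let inn : InPort {t : D.Split // t ≠ s} {n : D.Merge // n ≠ m} → InPort D.Split D.Merge :=
    Sum.map Subtype.val (Prod.map Subtype.val id)
  have hout : Injective out :=
    (Subtype.val_injective.prodMap injective_id).sumMap Subtype.val_injective
  have hinn : Injective inn :=
    Subtype.val_injective.sumMap (Subtype.val_injective.prodMap injective_id)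
  have houty : ∀ o, D.out (out o) ≠ y := by
    rintro (⟨⟨t, ht⟩, i⟩ | ⟨n, hn⟩) h
    · simpa [out] using D.out_injective (h.trans hmy.symm)
    · exact hn (by simpa [out] using D.out_injective (h.trans hmy.symm))
  have hinny : ∀ o, D.inn (inn o) ≠ y := by
    rintro (⟨t, ht⟩ | ⟨⟨n, hn⟩, i⟩) h
    · exact ht (by simpa [inn] using D.inn_injective (h.trans hsy.symm))
    · simpa [inn] using D.inn_injective (h.trans hsy.symm)
  have houtb : ∀ o, D.out (out o) ∉ Set.range b := by
    rintro (⟨⟨t, ht⟩, i⟩ | ⟨n, hn⟩) ⟨j, h⟩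
    · have := D.out_injective h
      simp only [Sum.inl.injEq, Prod.mk.injEq, out, Sum.map_inl, Prod.map] at this
      exact ht this.1.symm
    · simpa [out] using D.out_injective h
  have hinna : ∀ o, D.inn (inn o) ∉ Set.range a := by
    rintro (⟨t, ht⟩ | ⟨⟨n, hn⟩, i⟩) ⟨j, h⟩
    · simpa [inn] using D.inn_injective h
    · have := D.inn_injective h
      simp only [Sum.inr.injEq, Prod.mk.injEq, inn, Sum.map_inr, Prod.map] at this
      exact hn this.1.symm
  have hexout : ∀ x, x ≠ y → x ∈ Set.range D.out → x ∉ Set.range b → ∃ o, D.out (out o) = x := by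
    rintro x hx ⟨⟨t, i⟩ | n, rfl⟩ hxb
    · have ht : t ≠ s := by rintro rfl; exact hxb ⟨i, rfl⟩
      exact ⟨.inl (⟨t, ht⟩, i), rfl⟩
    · have hn : n ≠ m := by rintro rfl; exact hx hmy
      exact ⟨.inr ⟨n, hn⟩, rfl⟩
  have hexinn : ∀ x, x ≠ y → x ∈ Set.range D.inn → x ∉ Set.range a → ∃ o, D.inn (inn o) = x := by
    rintro x hx ⟨t | ⟨n, i⟩, rfl⟩ hxa
    · have ht : t ≠ s := by rintro rfl; exact hx hsy
      exact ⟨.inl ⟨t, ht⟩, rfl⟩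
    · have hn : n ≠ m := by rintro rfl; exact hxa ⟨i, rfl⟩
      exact ⟨.inr (⟨n, hn⟩, i), rfl⟩
  let D' : CylinderDiagram :=
    { Edge := Quotient K
      Split := {t : D.Split // t ≠ s}
      Merge := {n : D.Merge // n ≠ m}
      out := fun o => joined (D.out (out o))
      inn := fun i => joined (D.inn (inn i))
      out_injective := fun o o' h => hout (D.out_injective
        (eq_of_eqvGen_of_notMem_range_right ha hb ((hj _ _ (houty _) (houty _)).1 h)
          (houtb _) (houtb _)))
      inn_injective := fun o o' h => hinn (D.inn_injective
        (eq_of_eqvGen_of_notMem_range_left ha hb ((hj _ _ (hinny _) (hinny _)).1 h)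
          (hinna _) (hinna _)))
      range_eq := by
        apply Set.Subset.antisymm
        · rintro _ ⟨o, rfl⟩
          obtain ⟨z, hz, hza, hz'⟩ := exists_eqvGen_notMem_range ha hb (houtb o)
          have hzy : z ≠ y := by
            rcases hz' with rfl | ⟨i, rfl⟩
            exacts [houty o, hby i]
          have hzr : z ∈ Set.range D.out := by
            rcases hz' with rfl | ⟨i, rfl⟩
            exacts [⟨_, rfl⟩, ⟨_, rfl⟩]
          obtain ⟨i, hi⟩ := hexinn z hzy (D.range_eq ▸ hzr) hza
          refine ⟨i, ?_⟩
          beta_reduce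
          rw [hi, hj _ _ hzy (houty o)]
          exact hz.symm
        · rintro _ ⟨o, rfl⟩
          obtain ⟨z, hz, hza, hz'⟩ := exists_eqvGen_notMem_range hb ha (hinna o)
          have hzy : z ≠ y := by
            rcases hz' with rfl | ⟨i, rfl⟩
            exacts [hinny o, hay i]
          have hzr : z ∈ Set.range D.inn := by
            rcases hz' with rfl | ⟨i, rfl⟩
            exacts [⟨_, rfl⟩, ⟨_, rfl⟩]
          obtain ⟨i, hi⟩ := hexout z hzy (D.range_eq ▸ hzr) hza
          refine ⟨i, ?_⟩
          beta_reduce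
          rw [hi, hj _ _ hzy (hinny o)]
          exact junction_eqvGen_flip hz.symm
      label := fun e' => (∑ x : D.Edge, if x ≠ y ∧ joined x = e' then D.label x else 0) +
        ∑ i : Bool, if joined (D.inn (.inr (m, i))) = e' then D.label y else 0 }
  refine ⟨D', m, s, y, joined, Equiv.refl _, Equiv.refl _, ⟨hmy, hsy⟩, ?_, hj, fun _ => rfl,
    fun _ _ => rfl, fun _ _ => rfl, fun _ => rfl, fun e' => ?_⟩
  swap
  · simp only [D']
    congr!
  intro e'
  obtain ⟨⟨x, hx⟩, rfl⟩ := Quotient.exists_rep e'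
  exact ⟨x, hx, hjoined x hx⟩

end CylinderDiagram

/-! ### Orbits and attractors -/

theorem zpow_apply_eq_iff {g : Cantor ≃ₜ Cantor} {x : Cantor} {m n : ℤ} :
    (g ^ m) x = (g ^ n) x ↔ (g ^ (m - n)) x = x := by
  rw [sub_eq_neg_add, zpow_add, zpow_neg]
  change _ ↔ (g ^ n).symm ((g ^ m) x) = x
  rw [Homeomorph.symm_apply_eq]

/-- The points of the orbit correspond to the residues modulo `L`. -/
theorem orbitOf_of_stabilizer {g : Cantor ≃ₜ Cantor} {x : Cantor} {L : ℕ} (hL : 0 < L)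
    (h : ∀ m : ℤ, (g ^ m) x = x ↔ (L : ℤ) ∣ m) :
    (orbitOf g x).Finite ∧ (orbitOf g x).ncard = L := by
  have hL' : (0 : ℤ) < L := by exact_mod_cast hL
  have heq : orbitOf g x = (fun n : ℕ => (g ^ (n : ℤ)) x) '' (Finset.range L : Set ℕ) := by
    ext z
    constructor
    · rintro ⟨n, rfl⟩
      refine ⟨(n % L).toNat, ?_, ?_⟩
      · have := Int.emod_lt_of_pos n hL'
        have := Int.emod_nonneg n hL'.ne'
        simp only [Finset.coe_range, Set.mem_Iio]
        omega
      · beta_reduce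
        rw [Int.toNat_of_nonneg (Int.emod_nonneg n hL'.ne'), zpow_apply_eq_iff, h]
        exact Dvd.intro (-(n / L)) (by rw [Int.emod_def]; ring)
    · rintro ⟨n, -, rfl⟩
      exact ⟨n, rfl⟩
  rw [heq]
  refine ⟨(Finset.finite_toSet _).image _, ?_⟩
  rw [Set.InjOn.ncard_image, Set.ncard_coe_finset, Finset.card_range]
  intro i hi j hj hij
  simp only [Finset.coe_range, Set.mem_Iio] at hi hj
  obtain ⟨t, ht⟩ := (h _).1 (zpow_apply_eq_iff.1 hij)
  have h1 : (i : ℤ) - j < L := by omega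
  have h2 : -(L : ℤ) < (i : ℤ) - j := by omega
  have ht0 : t = 0 := by nlinarith
  subst ht0
  omega

theorem exists_zpow_apply_eq_of_finite {g : Cantor ≃ₜ Cantor} {x : Cantor}
    (h : (orbitOf g x).Finite) : ∃ m : ℤ, m ≠ 0 ∧ (g ^ m) x = x := by
  by_contra! hc
  refine Set.infinite_range_of_injective (f := fun n : ℤ => (g ^ n) x) ?_ h
  intro m n hmn
  by_contra hne
  exact hc (m - n) (sub_ne_zero.2 hne) (zpow_apply_eq_iff.1 hmn)

theorem Cantor.IsContracting.tendsto_iterate {f : Cantor → Cantor} (hf : IsContracting f)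
    {w : Cantor} (hw : f w = w) {V : Set Cantor} (hV : V ∈ 𝓝 w) :
    ∃ N : ℕ, ∀ n ≥ N, ∀ w', f^[n] w' ∈ V := by
  obtain ⟨N, hN⟩ := mem_nhds_iff_agree.1 hV
  refine ⟨N, fun n hn w' => hN _ fun i hi => ?_⟩
  have := hf.iterate_apply_eq n w' w i (by omega)
  rwa [iterate_fixed hw] at this

/-- The chart `φ` carries `f` to `h ^ k`, and its whole range serves as the neighbourhood, since the
iterates of `f` shrink all words uniformly. -/
theorem isAttractor_of_contracting {h : Cantor ≃ₜ Cantor} {φ f : Cantor → Cantor}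
    (hf : Cantor.IsContracting f) {w : Cantor} (hw : f w = w)
    (hφ : Filter.map φ (𝓝 w) = 𝓝 (φ w)) {k : ℕ} (hk : 0 < k)
    (hh : ∀ w, (h ^ k) (φ w) = φ (f w)) : IsAttractor h (φ w) := by
  refine ⟨k, hk, by rw [hh, hw], Set.range φ, ?_, ?_, ?_⟩
  · rw [← hφ, Filter.mem_map]
    simp
  · rintro _ ⟨w', rfl⟩
    exact ⟨f w', (hh w').symm⟩
  · intro W hW
    rw [← hφ, Filter.mem_map] at hW
    obtain ⟨N, hN⟩ := hf.tendsto_iterate hw hW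
    refine ⟨N, fun n hn => ?_⟩
    rintro _ ⟨w', rfl⟩
    have : ∀ n, ((h ^ k) ^ n) (φ w') = φ (f^[n] w') := by
      intro n
      induction n with
      | zero => rfl
      | succ n ih =>
        rw [pow_succ', iterate_succ_apply', ← hh, ← ih]; rfl
    rw [this]
    exact hN n hn w'

/-! ### First returns along merge and split cycles. -/

namespace CylinderDiagram

variable {D : CylinderDiagram} {g : Cantor ≃ₜ Cantor} {Ψ : D.FlowSpace → Cantor}

/-- The flow returns to the edge `e` always by the contraction `f`, in time `L`. -/
structure IsContractingReturn (e : D.Edge) (f : Cantor → Cantor) (L : ℤ) : Prop where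
  contracting : Cantor.IsContracting f
  flow : ∀ w n, D.flow.SameCycle (e, w, n) (e, f w, n - L)
  sameCycle : ∀ w w' n n', D.flow.SameCycle (e, w, n) (e, w', n') →
    ∃ q : ℕ, (w' = f^[q] w ∧ n' = n - q * L) ∨ (w = f^[q] w' ∧ n = n' - q * L)

theorem IsModel.zpow_apply_eq_iff (hΨ : D.IsModel g Ψ) (e : D.Edge) (w : Cantor) (n m : ℤ) :
    (g ^ m) (Ψ (e, w, n)) = Ψ (e, w, n) ↔ D.flow.SameCycle (e, w, n + m) (e, w, n) := by
  rw [← hΨ.shift_zpow, hΨ.eq_iff]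

namespace IsContractingReturn

variable {e : D.Edge} {f : Cantor → Cantor} {L : ℤ} {w : Cantor}

theorem zpow_apply (hr : IsContractingReturn e f L) (hΨ : D.IsModel g Ψ) (w : Cantor) (n : ℤ) :
    (g ^ L) (Ψ (e, w, n)) = Ψ (e, f w, n) := by
  rw [(hΨ.eq_iff _ _).2 (hr.flow w n), ← hΨ.shift_zpow, sub_add_cancel]

/-- With return time zero, `Ψ` on the edge would be invariant under `f`, hence constant by
contraction and continuity; but its image is a neighbourhood, and no point is isolated. -/
theorem ne_zero (hr : IsContractingReturn e f L) (hΨ : D.IsModel g Ψ) : L ≠ 0 := by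
  rintro rfl
  obtain ⟨w, hw⟩ := hr.contracting.exists_fixed
  have hiter : ∀ q w', Ψ (e, f^[q] w', 0) = Ψ (e, w', 0) := by
    intro q w'
    induction q with
    | zero => rfl
    | succ q ih =>
      rw [iterate_succ_apply', ← hr.zpow_apply hΨ, ih]; rfl
  have hconst : ∀ w', Ψ (e, w', 0) = Ψ (e, w, 0) := by
    intro w'
    by_contra hne
    have h1 : {Ψ (e, w', 0)}ᶜ ∈ 𝓝 (Ψ (e, w, 0)) :=
      isOpen_compl_singleton.mem_nhds fun h => hne (Eq.symm h)
    rw [← hΨ.map_nhds, Filter.mem_map] at h1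
    obtain ⟨N, hN⟩ := hr.contracting.tendsto_iterate hw h1
    exact hN N le_rfl w' (hiter N w')
  refine Cantor.singleton_notMem_nhds (Ψ (e, w, 0)) ?_
  rw [← hΨ.map_nhds, Filter.mem_map]
  convert Filter.univ_mem
  ext w'
  simpa using hconst w'

/-- Returning at a different time means that some positive iterate of `f` fixes the word, and a
contraction has only one periodic point. -/
theorem eq_of_zpow_apply_eq (hr : IsContractingReturn e f L) (hΨ : D.IsModel g Ψ)
    (hw : f w = w) {w' : Cantor} {n m : ℤ} (hm : m ≠ 0)
    (h : (g ^ m) (Ψ (e, w', n)) = Ψ (e, w', n)) : w' = w := by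
  obtain ⟨q, hq⟩ := hr.sameCycle _ _ _ _ ((hΨ.zpow_apply_eq_iff _ _ _ _).1 h)
  have hq0 : q ≠ 0 := by
    rintro rfl
    apply hm
    rcases hq with ⟨-, h⟩ | ⟨-, h⟩ <;> simp at h <;> omega
  exact hr.contracting.eq_of_iterate_eq hw (Nat.pos_of_ne_zero hq0)
    (by rcases hq with ⟨h, -⟩ | ⟨h, -⟩ <;> exact h.symm)

theorem zpow_apply_eq_iff (hr : IsContractingReturn e f L) (hΨ : D.IsModel g Ψ)
    (hw : f w = w) (n m : ℤ) : (g ^ m) (Ψ (e, w, n)) = Ψ (e, w, n) ↔ L ∣ m := by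
  constructor
  · intro h
    obtain ⟨q, hq⟩ := hr.sameCycle _ _ _ _ ((hΨ.zpow_apply_eq_iff _ _ _ _).1 h)
    rcases hq with ⟨-, h⟩ | ⟨-, h⟩
    · exact ⟨q, by linarith⟩
    · exact ⟨-q, by linarith⟩
  · rintro ⟨t, rfl⟩
    have h1 : (g ^ L) (Ψ (e, w, n)) = Ψ (e, w, n) := by rw [hr.zpow_apply hΨ, hw]
    rw [zpow_mul]
    generalize g ^ L = h at h1
    induction t with
    | zero => rfl
    | succ t ih => rw [add_comm, zpow_one_add]; exact (congrArg h ih).trans h1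
    | pred t ih =>
      rw [sub_eq_neg_add, zpow_add, zpow_neg_one]
      change h.symm ((h ^ (-(t : ℤ))) _) = _
      rw [ih, Homeomorph.symm_apply_eq, h1]

theorem orbit (hr : IsContractingReturn e f L) (hΨ : D.IsModel g Ψ) (hw : f w = w) (n : ℤ) :
    (orbitOf g (Ψ (e, w, n))).Finite ∧ (orbitOf g (Ψ (e, w, n))).ncard = L.natAbs :=
  orbitOf_of_stabilizer (Int.natAbs_pos.2 (hr.ne_zero hΨ)) fun m => by
    rw [hr.zpow_apply_eq_iff hΨ hw, Int.natAbs_dvd]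

open scoped Fin.NatCast in
/-- A cycle on which the flow, forwards or backwards, always adds letters. -/
theorem of_cycle {τ : Equiv.Perm D.FlowSpace} (hτ : τ = D.flow ∨ τ = D.flow⁻¹) {k : ℕ}
    {c : Fin (k + 1) → D.Edge} (hc : Injective c) {b : Fin (k + 1) → Bool} {l : Fin (k + 1) → ℤ}
    (h : ∀ i w n, τ (c i, w, n) = (c (i + 1), Cantor.cons (b i) w, n - l i)) :
    ∃ f, IsContractingReturn (c 0) f (∑ i, l i) := by
  -- `F j` puts on the letters of the first `j` steps, the latest one in front.
  let F : ℕ → Cantor → Cantor := fun j =>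
    Nat.rec id (fun j Fj w => Cantor.cons (b (j : Fin (k + 1))) (Fj w)) j
  have hF : ∀ j, F j = id ∨ Cantor.IsContracting (F j) := by
    intro j
    induction j with
    | zero => exact Or.inl rfl
    | succ j ih => exact Or.inr (Cantor.IsContracting.cons _ ih)
  have hF' : Cantor.IsContracting (F (k + 1)) := Cantor.IsContracting.cons _ (hF k)
  have hpow : ∀ (j : ℕ) w n, (τ ^ j) (c 0, w, n) =
      (c (j : Fin (k + 1)), F j w, n - ∑ i ∈ Finset.range j, l (i : Fin (k + 1))) := by
    intro j w n
    induction j with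
    | zero => simp [F]
    | succ j ih =>
      rw [pow_succ', Equiv.Perm.mul_apply, ih, h, Finset.sum_range_succ, Nat.cast_succ, sub_sub]
  have hsum : ∑ i ∈ Finset.range (k + 1), l (i : Fin (k + 1)) = ∑ i, l i := by
    rw [← Fin.sum_univ_eq_sum_range (fun i => l (i : Fin (k + 1)))]
    simp
  have hret : ∀ w n, (τ ^ (k + 1)) (c 0, w, n) = (c 0, F (k + 1) w, n - ∑ i, l i) := by
    intro w n
    rw [hpow, hsum]
    simp
  have hret' : ∀ (q : ℕ) w n, (τ ^ ((k + 1) * q)) (c 0, w, n) =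
      (c 0, (F (k + 1))^[q] w, n - q * ∑ i, l i) := by
    intro q w n
    induction q with
    | zero => simp
    | succ q ih =>
      rw [mul_add, mul_one, add_comm, pow_add, Equiv.Perm.mul_apply, ih, hret,
        iterate_succ_apply']
      congr 2
      push_cast
      ring
  have hsame : ∀ p q, D.flow.SameCycle p q ↔ τ.SameCycle p q := by
    intro p q
    rcases hτ with rfl | rfl
    · rfl
    · exact Equiv.Perm.sameCycle_inv.symm
  refine ⟨F (k + 1), hF', fun w n => (hsame _ _).2 ⟨(k + 1 : ℕ), ?_⟩, ?_⟩
  · rw [zpow_natCast, hret]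
  · intro w w' n n' hs
    have key : ∀ (j : ℕ) w w' n n', (τ ^ j) (c 0, w, n) = (c 0, w', n') →
        ∃ q : ℕ, w' = (F (k + 1))^[q] w ∧ n' = n - q * ∑ i, l i := by
      intro j w w' n n' hj
      -- The edges of the cycle are distinct, so it is back at `c 0` only after a multiple of `k +
      -- 1` steps.
      have h1 := congrArg Prod.fst ((hpow j w n).symm.trans hj)
      obtain ⟨q, rfl⟩ := (Fin.natCast_eq_zero).1 (hc h1)
      rw [hret'] at hj
      simp only [Prod.mk.injEq, true_and] at hj
      exact ⟨q, hj.1.symm, hj.2.symm⟩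
    obtain ⟨j, hj⟩ := (hsame _ _).1 hs
    obtain ⟨j, rfl | rfl⟩ := j.eq_nat_or_neg
    · rw [zpow_natCast] at hj
      obtain ⟨q, hq⟩ := key j _ _ _ _ hj
      exact ⟨q, Or.inl hq⟩
    · rw [zpow_neg, zpow_natCast, Equiv.Perm.inv_eq_iff_eq] at hj
      obtain ⟨q, hq⟩ := key j _ _ _ _ hj.symm
      exact ⟨q, Or.inr hq⟩

end IsContractingReturn

theorem IsMergeCycle.exists_return {k : ℕ} {c : Fin (k + 1) → D.Edge} (hc : D.IsMergeCycle c) :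
    ∃ f, IsContractingReturn (c 0) f (D.labelSum c) := by
  obtain ⟨⟨hinj, hfol⟩, hm⟩ := hc
  choose m b hmb using hm
  have := IsContractingReturn.of_cycle (τ := D.flow) (Or.inl rfl) hinj (b := b)
    (l := fun i => D.label (c i)) ?_
  · simpa [labelSum] using this
  · intro i w n
    have h1 : c (i + 1) = D.out (.inr (m i)) := by
      have := hfol i
      rw [hmb i] at this
      generalize h1 : D.inn (.inr (m i, b i)) = x, c (i + 1) = z at this
      cases this with
      | split s b' => simpa using D.inn_injective h1
      | merge m' b' =>
        have := D.inn_injective h1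
        simp only [Sum.inr.injEq, Prod.mk.injEq] at this
        rw [this.1]
    rw [h1, hmb i, flow_merge]

/-- Read backwards, a split has one exit and adds a letter, so the inverse flow is the contracting
one. -/
theorem IsSplitCycle.exists_return {k : ℕ} {c : Fin (k + 1) → D.Edge} (hc : D.IsSplitCycle c) :
    ∃ f, IsContractingReturn (c 0) f (-(D.labelSum c : ℤ)) := by
  obtain ⟨⟨hinj, hfol⟩, hm⟩ := hc
  choose s hs using hm
  have hout : ∀ i, ∃ b, c (i + 1) = D.out (.inl (s i, b)) := by
    intro i
    have := hfol i
    rw [hs i] at this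
    generalize h1 : D.inn (.inl (s i)) = x, c (i + 1) = z at this
    cases this with
    | split s' b' =>
      have := D.inn_injective h1
      simp only [Sum.inl.injEq] at this
      exact ⟨b', by rw [this]⟩
    | merge m' b' => simpa using D.inn_injective h1
  choose b hb using hout
  -- The index `-i` reverses the cycle. A backward step raises the clock by the label of the edge it
  -- enters, hence the shifted index and the sign.
  have := IsContractingReturn.of_cycle (τ := D.flow⁻¹) (Or.inr rfl) (c := fun i => c (-i))
    (hinj.comp neg_injective) (b := fun i => b (-(i + 1)))
    (l := fun i => -(D.label (c (-(i + 1))) : ℤ)) ?_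
  · rw [neg_zero, Finset.sum_neg_distrib,
      show ∑ x, (D.label (c (-(x + 1))) : ℤ) = ∑ x, (D.label (c x) : ℤ) from
        Equiv.sum_comp ((Equiv.addRight 1).trans (Equiv.neg _)) (fun i => (D.label (c i) : ℤ))]
      at this
    simpa [labelSum] using this
  · intro i w n
    have h1 : c (-i) = D.out (.inl (s (-(i + 1)), b (-(i + 1)))) := by
      rw [← hb]; congr 1; abel
    rw [h1, flow_inv_split, ← hs, sub_neg_eq_add]

/-! ### Reduced diagrams -/

theorem IsReduced.out_merge (hD : D.IsReduced) (m : D.Merge) :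
    ∃ m' b, D.out (.inr m) = D.inn (.inr (m', b)) := by
  rcases edge_cases_inn (D.out (.inr m)) with ⟨s, h⟩ | h | h
  · exact absurd ⟨m, s, _, h, rfl⟩ hD
  · exact h
  · exact absurd ⟨_, rfl⟩ h

theorem IsReduced.inn_split (hD : D.IsReduced) (s : D.Split) :
    ∃ s' b, D.inn (.inl s) = D.out (.inl (s', b)) := by
  rcases edge_cases_out (D.inn (.inl s)) with h | ⟨m, h⟩ | h
  · exact h
  · exact absurd ⟨m, s, _, h.symm, rfl⟩ hD
  · exact absurd (D.range_eq ▸ ⟨_, rfl⟩) h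

/-- An edge with neither property would lead from a merge to a split. -/
theorem IsReduced.merge_or_split (hD : D.IsReduced) {e : D.Edge} (he : ¬ D.IsCircle e) :
    (∃ m b, e = D.inn (.inr (m, b))) ∨ ∃ s b, e = D.out (.inl (s, b)) := by
  rcases edge_cases_out e with h | ⟨m, rfl⟩ | h
  · exact Or.inr h
  · exact Or.inl (hD.out_merge m)
  · exact absurd h he

open scoped Fin.NatCast in
theorem IsReduced.mergeCycle_or_splitCycle (hD : D.IsReduced) {k : ℕ} {c : Fin (k + 1) → D.Edge}
    (hc : D.IsCycle c) : D.IsMergeCycle c ∨ D.IsSplitCycle c := by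
  by_cases h : ∃ i, ∃ m b, c i = D.inn (.inr (m, b))
  · left
    refine ⟨hc, ?_⟩
    obtain ⟨i, hi⟩ := h
    have key : ∀ j : ℕ, ∃ m b, c (i + (j : Fin (k + 1))) = D.inn (.inr (m, b)) := by
      intro j
      induction j with
      | zero => simpa using hi
      | succ j ih =>
        obtain ⟨m, b, hm⟩ := ih
        have hf := hc.2 (i + j)
        rw [hm] at hf
        rw [Nat.cast_succ, ← add_assoc]
        generalize h1 : D.inn (.inr (m, b)) = x, c (i + j + 1) = z at hf
        cases hf with
        | split s b' => simpa using D.inn_injective h1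
        | merge m' b' => exact hD.out_merge m'
    intro j
    have := key (j - i).val
    rwa [Fin.cast_val_eq_self, add_sub_cancel] at this
  · right
    refine ⟨hc, fun i => ?_⟩
    have hf := hc.2 i
    generalize h1 : c i = x, c (i + 1) = z at hf
    cases hf with
    | split s b => exact ⟨s, rfl⟩
    | merge m b => exact absurd ⟨i, m, b, h1⟩ h

/-- The length `k + 1` is the minimal period, which makes the iterates distinct. -/
theorem exists_fin_cycle {α : Type*} {F : α → α} {e : α} {j : ℕ} (hj : 0 < j)
    (h : F^[j] e = e) : ∃ (k : ℕ) (c : Fin (k + 1) → α), Injective c ∧ c 0 = e ∧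
      (∀ i, c (i + 1) = F (c i)) ∧ ∀ i, ∃ n, c i = F^[n] e := by
  have hp : 0 < minimalPeriod F e := minimalPeriod_pos_of_mem_periodicPts ⟨j, hj, h⟩
  obtain ⟨k, hk⟩ := Nat.exists_eq_succ_of_ne_zero hp.ne'
  refine ⟨k, fun i => F^[i.val] e, ?_, rfl, ?_, fun i => ⟨_, rfl⟩⟩
  · intro i i' h
    refine Fin.ext (iterate_injOn_Iio_minimalPeriod (f := F) (x := e) ?_ ?_ h) <;>
    · simp only [Set.mem_Iio, hk]
      exact Fin.is_lt _
  · intro i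
    beta_reduce
    rw [← iterate_succ_apply' F, ← iterate_mod_minimalPeriod_eq (n := i.val.succ), hk,
      Fin.val_add, Fin.val_one', Nat.add_mod_mod]

end CylinderDiagram

/-! ### Forced paths in reduced diagrams. -/

namespace CylinderDiagram

variable {D : CylinderDiagram} {g : Cantor ≃ₜ Cantor} {Ψ : D.FlowSpace → Cantor}

variable (D) in
/-- The edge after `e`, when `e` ends at a merge. -/
noncomputable def nextEdge (e : D.Edge) : D.Edge := (D.flow (e, fun _ => false, 0)).1

variable (D) in
/-- The edge before `e`, when `e` starts at a split. -/
noncomputable def prevEdge (e : D.Edge) : D.Edge := (D.flow⁻¹ (e, fun _ => false, 0)).1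

theorem nextEdge_merge (m : D.Merge) (b : Bool) :
    D.nextEdge (D.inn (.inr (m, b))) = D.out (.inr m) := by
  rw [nextEdge, flow_merge]

theorem prevEdge_split (s : D.Split) (b : Bool) :
    D.prevEdge (D.out (.inl (s, b))) = D.inn (.inl s) := by
  rw [prevEdge, flow_inv_split]

theorem IsReduced.iterate_nextEdge (hD : D.IsReduced) {e : D.Edge}
    (he : ∃ m b, e = D.inn (.inr (m, b))) (j : ℕ) :
    ∃ m b, D.nextEdge^[j] e = D.inn (.inr (m, b)) := by
  induction j with
  | zero => exact he
  | succ j ih =>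
    obtain ⟨m, b, h⟩ := ih
    rw [iterate_succ_apply', h, nextEdge_merge]
    exact hD.out_merge m

theorem IsReduced.iterate_prevEdge (hD : D.IsReduced) {e : D.Edge}
    (he : ∃ s b, e = D.out (.inl (s, b))) (j : ℕ) :
    ∃ s b, D.prevEdge^[j] e = D.out (.inl (s, b)) := by
  induction j with
  | zero => exact he
  | succ j ih =>
    obtain ⟨s, b, h⟩ := ih
    rw [iterate_succ_apply', h, prevEdge_split]
    exact hD.inn_split s

/-- A merge has a single exit and is followed by another merge, so the word has no influence on the
path. -/
theorem IsReduced.flow_pow_fst (hD : D.IsReduced) {e : D.Edge}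
    (he : ∃ m b, e = D.inn (.inr (m, b))) (j : ℕ) (w : Cantor) (n : ℤ) :
    ((D.flow ^ j) (e, w, n)).1 = D.nextEdge^[j] e := by
  induction j with
  | zero => rfl
  | succ j ih =>
    obtain ⟨m, b, h⟩ := hD.iterate_nextEdge he j
    rw [iterate_succ_apply', pow_succ', Equiv.Perm.mul_apply]
    generalize (D.flow ^ j) (e, w, n) = p at ih
    obtain ⟨e', w', n'⟩ := p
    obtain rfl : e' = _ := ih
    rw [h, nextEdge_merge, flow_merge]

theorem IsReduced.flow_inv_pow_fst (hD : D.IsReduced) {e : D.Edge}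
    (he : ∃ s b, e = D.out (.inl (s, b))) (j : ℕ) (w : Cantor) (n : ℤ) :
    ((D.flow⁻¹ ^ j) (e, w, n)).1 = D.prevEdge^[j] e := by
  induction j with
  | zero => rfl
  | succ j ih =>
    obtain ⟨s, b, h⟩ := hD.iterate_prevEdge he j
    rw [iterate_succ_apply', pow_succ', Equiv.Perm.mul_apply]
    generalize (D.flow⁻¹ ^ j) (e, w, n) = p at ih
    obtain ⟨e', w', n'⟩ := p
    obtain rfl : e' = _ := ih
    rw [h, prevEdge_split, flow_inv_split]

theorem IsReduced.exists_mergeCycle (hD : D.IsReduced) {e : D.Edge}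
    (he : ∃ m b, e = D.inn (.inr (m, b))) {j : ℕ} (hj : 0 < j) (h : D.nextEdge^[j] e = e) :
    ∃ (k : ℕ) (c : Fin (k + 1) → D.Edge), D.IsMergeCycle c ∧ c 0 = e := by
  obtain ⟨k, c, hc, hc0, hF, hit⟩ := exists_fin_cycle hj h
  have hm : ∀ i, ∃ m b, c i = D.inn (.inr (m, b)) := by
    intro i
    obtain ⟨n, hn⟩ := hit i
    rw [hn]; exact hD.iterate_nextEdge he n
  refine ⟨k, c, ⟨⟨hc, fun i => ?_⟩, hm⟩, hc0⟩
  obtain ⟨m, b, h⟩ := hm i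
  rw [hF, h, nextEdge_merge]
  exact .merge m b

theorem IsReduced.exists_splitCycle (hD : D.IsReduced) {e : D.Edge}
    (he : ∃ s b, e = D.out (.inl (s, b))) {j : ℕ} (hj : 0 < j) (h : D.prevEdge^[j] e = e) :
    ∃ (k : ℕ) (c : Fin (k + 1) → D.Edge), D.IsSplitCycle c ∧ c 0 = e := by
  obtain ⟨k, c, hc, hc0, hF, hit⟩ := exists_fin_cycle hj h
  have hs : ∀ i, ∃ s b, c (-(i + 1)) = D.out (.inl (s, b)) ∧ c (-i) = D.inn (.inl s) := by
    intro i
    obtain ⟨n, hn⟩ := hit (-(i + 1))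
    obtain ⟨s, b, h⟩ := hD.iterate_prevEdge he n
    rw [← hn] at h
    refine ⟨s, b, h, ?_⟩
    rw [← prevEdge_split s b, ← h, ← hF]
    congr 1
    abel
  -- `c` runs along `prevEdge`, against the direction of the edges.
  refine ⟨k, fun i => c (-i), ⟨⟨hc.comp neg_injective, fun i => ?_⟩, fun i => ?_⟩, ?_⟩
  · obtain ⟨s, b, h1, h2⟩ := hs i
    beta_reduce
    rw [h1, h2]
    exact .split s b
  · obtain ⟨s, b, h1, h2⟩ := hs i
    exact ⟨s, h2⟩
  · simpa using hc0

theorem exists_iterate_eq {α : Type*} [Finite α] (F : α → α) (e : α) :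
    ∃ i j, 0 < j ∧ F^[j] (F^[i] e) = F^[i] e := by
  obtain ⟨i, i', hne, h⟩ := Finite.exists_ne_map_eq_of_infinite fun n => F^[n] e
  rcases lt_or_gt_of_ne hne with hlt | hlt
  · exact ⟨i, i' - i, by omega, by
      rw [← iterate_add_apply, Nat.sub_add_cancel hlt.le]; exact h.symm⟩
  · exact ⟨i', i - i', by omega, by
      rw [← iterate_add_apply, Nat.sub_add_cancel hlt.le]; exact h⟩

/-- Splits have two outputs and one input, merges the reverse, and the non-circular edges match
outputs with inputs. -/
theorem card_split_eq_card_merge (D : CylinderDiagram) :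
    Fintype.card D.Split = Fintype.card D.Merge := by
  have e : OutPort D.Split D.Merge ≃ InPort D.Split D.Merge :=
    (Equiv.ofInjective _ D.out_injective).trans
      ((Equiv.setCongr D.range_eq).trans (Equiv.ofInjective _ D.inn_injective).symm)
  have := Fintype.card_congr e
  simp only [Fintype.card_sum, Fintype.card_prod, Fintype.card_bool] at this
  omega

theorem nonempty_of_not_isUnionOfCircles (h : ¬ D.IsUnionOfCircles) :
    Nonempty D.Split ∧ Nonempty D.Merge := by
  have hcard := card_split_eq_card_merge D
  rw [IsUnionOfCircles, ← Fintype.card_eq_zero_iff, ← Fintype.card_eq_zero_iff] at h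
  rw [← Fintype.card_pos_iff, ← Fintype.card_pos_iff]
  omega

theorem IsReduced.exists_isMergeCycle (hD : D.IsReduced) (m : D.Merge) :
    ∃ (k : ℕ) (c : Fin (k + 1) → D.Edge), D.IsMergeCycle c := by
  obtain ⟨i, j, hj, h⟩ := exists_iterate_eq D.nextEdge (D.inn (.inr (m, false)))
  obtain ⟨k, c, hc, -⟩ := hD.exists_mergeCycle (hD.iterate_nextEdge ⟨m, false, rfl⟩ i) hj h
  exact ⟨k, c, hc⟩

theorem IsReduced.exists_isSplitCycle (hD : D.IsReduced) (s : D.Split) :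
    ∃ (k : ℕ) (c : Fin (k + 1) → D.Edge), D.IsSplitCycle c := by
  obtain ⟨i, j, hj, h⟩ := exists_iterate_eq D.prevEdge (D.out (.inl (s, false)))
  obtain ⟨k, c, hc, -⟩ := hD.exists_splitCycle (hD.iterate_prevEdge ⟨s, false, rfl⟩ i) hj h
  exact ⟨k, c, hc⟩

/-! ### Circles -/

theorem IsCircle.flow_zpow {e : D.Edge} (he : D.IsCircle e) (k : ℤ) (w : Cantor) (n : ℤ) :
    (D.flow ^ k) (e, w, n) = (e, w, n - k * D.label e) := by
  induction k with
  | zero => simp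
  | succ k ih =>
    rw [add_comm, zpow_one_add, Equiv.Perm.mul_apply, ih, flow_circle he]
    congr 2; ring
  | pred k ih =>
    rw [sub_eq_neg_add, zpow_add, zpow_neg_one, Equiv.Perm.mul_apply, ih,
      Equiv.Perm.inv_eq_iff_eq, flow_circle he]
    congr 2; ring

theorem IsCircle.zpow_apply_eq_iff {e : D.Edge} (he : D.IsCircle e) (hΨ : D.IsModel g Ψ)
    (w : Cantor) (n m : ℤ) : (g ^ m) (Ψ (e, w, n)) = Ψ (e, w, n) ↔ (D.label e : ℤ) ∣ m := by
  rw [hΨ.zpow_apply_eq_iff]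
  constructor
  · rintro ⟨k, hk⟩
    rw [he.flow_zpow] at hk
    simp only [Prod.mk.injEq, true_and] at hk
    exact ⟨k, by linarith⟩
  · rintro ⟨k, rfl⟩
    refine ⟨k, ?_⟩
    rw [he.flow_zpow]
    congr 2; ring

/-- The orbit never leaves the circle, so the positive label which it meets is that of the circle.
-/
theorem IsCircle.label_pos {e : D.Edge} (he : D.IsCircle e) (hΨ : D.IsModel g Ψ) :
    0 < D.label e := by
  obtain ⟨q, ⟨k, hk⟩, hq⟩ := hΨ.pos (e, fun _ => false, 0)
  rw [he.flow_zpow] at hk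
  rwa [← hk] at hq

theorem IsCircle.orbit {e : D.Edge} (he : D.IsCircle e) (hΨ : D.IsModel g Ψ)
    (w : Cantor) (n : ℤ) :
    (orbitOf g (Ψ (e, w, n))).Finite ∧ (orbitOf g (Ψ (e, w, n))).ncard = D.label e :=
  orbitOf_of_stabilizer (he.label_pos hΨ) (he.zpow_apply_eq_iff hΨ w n)

theorem IsUnionOfCircles.isCircle (h : D.IsUnionOfCircles) (e : D.Edge) : D.IsCircle e := by
  obtain ⟨hS, hM⟩ := h
  rintro ⟨⟨s, -⟩ | m, -⟩
  exacts [hS.false s, hM.false m]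

/-- Every point lies on some circle and has period exactly its label, so `g ^ N` is trivial exactly
when all labels divide `N`. -/
theorem IsUnionOfCircles.orderOf_eq (h : D.IsUnionOfCircles) (hΨ : D.IsModel g Ψ) :
    IsOfFinOrder g ∧ orderOf g = Finset.univ.lcm D.label := by
  have key : ∀ N : ℕ, g ^ N = 1 ↔ Finset.univ.lcm D.label ∣ N := by
    intro N
    rw [Finset.lcm_dvd_iff]
    constructor
    · intro hN e _
      have := (h.isCircle e).zpow_apply_eq_iff hΨ (fun _ => false) 0 N
      rw [zpow_natCast, hN] at this
      exact Int.natCast_dvd_natCast.1 (this.1 rfl)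
    · intro hN
      ext1 x
      obtain ⟨⟨e, w, n⟩, rfl⟩ := hΨ.surjective x
      have := (h.isCircle e).zpow_apply_eq_iff hΨ w n N
      rw [zpow_natCast] at this
      exact this.2 (Int.natCast_dvd_natCast.2 (hN e (Finset.mem_univ e)))
  have horder : orderOf g = Finset.univ.lcm D.label := by
    refine Nat.dvd_antisymm ?_ ((key _).1 (pow_orderOf_eq_one g))
    rw [orderOf_dvd_iff_pow_eq_one, key]
  refine ⟨?_, horder⟩
  rw [← orderOf_pos_iff, horder, Nat.pos_iff_ne_zero, Ne, Finset.lcm_eq_zero_iff]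
  rintro ⟨e, -, he⟩
  exact ((h.isCircle e).label_pos hΨ).ne' he

/-! ### Attractors, repellors and finite orbits -/

theorem IsMergeCycle.exists_attractor {k : ℕ} {c : Fin (k + 1) → D.Edge}
    (hc : D.IsMergeCycle c) (hΨ : D.IsModel g Ψ) :
    ∃ x, IsAttractor g x ∧ (orbitOf g x).Finite ∧ (orbitOf g x).ncard = D.labelSum c := by
  obtain ⟨f, hr⟩ := hc.exists_return
  obtain ⟨w, hw⟩ := hr.contracting.exists_fixed
  refine ⟨Ψ (c 0, w, 0), ?_, by simpa using hr.orbit hΨ hw 0⟩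
  refine isAttractor_of_contracting (φ := fun w => Ψ (c 0, w, 0)) (k := D.labelSum c)
    hr.contracting hw (hΨ.map_nhds _ _ _) ?_ fun w => ?_
  · have := hr.ne_zero hΨ
    omega
  · rw [← hr.zpow_apply hΨ, zpow_natCast]

theorem IsSplitCycle.exists_repellor {k : ℕ} {c : Fin (k + 1) → D.Edge}
    (hc : D.IsSplitCycle c) (hΨ : D.IsModel g Ψ) :
    ∃ x, IsRepellor g x ∧ (orbitOf g x).Finite ∧ (orbitOf g x).ncard = D.labelSum c := by
  obtain ⟨f, hr⟩ := hc.exists_return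
  obtain ⟨w, hw⟩ := hr.contracting.exists_fixed
  refine ⟨Ψ (c 0, w, 0), ?_, by simpa using hr.orbit hΨ hw 0⟩
  refine isAttractor_of_contracting (φ := fun w => Ψ (c 0, w, 0)) (k := D.labelSum c)
    hr.contracting hw (hΨ.map_nhds _ _ _) ?_ fun w => ?_
  · have := hr.ne_zero hΨ
    omega
  · rw [← hr.zpow_apply hΨ, ← zpow_natCast, inv_zpow, zpow_neg]

/-- On an edge of the cycle only the fixed word of the return is periodic. -/
theorem IsMergeCycle.not_isOfFinOrder {k : ℕ} {c : Fin (k + 1) → D.Edge}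
    (hc : D.IsMergeCycle c) (hΨ : D.IsModel g Ψ) : ¬ IsOfFinOrder g := by
  obtain ⟨f, hr⟩ := hc.exists_return
  obtain ⟨w, hw⟩ := hr.contracting.exists_fixed
  obtain ⟨w', hw'⟩ := Cantor.exists_ne_word w
  rw [isOfFinOrder_iff_pow_eq_one]
  rintro ⟨N, hN, h⟩
  refine hw' (hr.eq_of_zpow_apply_eq hΨ hw (n := 0) (m := N) (by omega) ?_)
  rw [zpow_natCast, h]; rfl

/-- A periodic point off the circles brings the flow back to its edge. The forced future or past of
that edge is then a cycle of merges or splits, and the word must be the fixed word of its return. -/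
theorem IsReduced.finiteOrbitLengths_eq (hD : D.IsReduced) (hΨ : D.IsModel g Ψ) :
    finiteOrbitLengths g = D.cycleSums := by
  ext L
  constructor
  · rintro ⟨x, hfin, rfl⟩
    obtain ⟨⟨e, w, n⟩, rfl⟩ := hΨ.surjective x
    by_cases he : D.IsCircle e
    · exact Or.inl ⟨e, he, (he.orbit hΨ w n).2.symm⟩
    right
    obtain ⟨m, hm, hgm⟩ := exists_zpow_apply_eq_of_finite hfin
    have hsame := (hΨ.zpow_apply_eq_iff _ _ _ _).1 hgm
    -- A negative power becomes positive by exchanging the end points, and it is not zero because `m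
    -- ≠ 0` changes the clock.
    have hpow : ∃ (j : ℕ) (n₁ n₂ : ℤ), 0 < j ∧ (D.flow ^ j) (e, w, n₁) = (e, w, n₂) := by
      obtain ⟨j, hj⟩ := hsame
      obtain ⟨j, rfl | rfl⟩ := j.eq_nat_or_neg
      · refine ⟨j, _, _, Nat.pos_of_ne_zero ?_, by rwa [zpow_natCast] at hj⟩
        rintro rfl
        simp [hm] at hj
      · refine ⟨j, n, n + m, Nat.pos_of_ne_zero ?_, ?_⟩
        · rintro rfl
          simp [hm] at hj
        · rw [zpow_neg, zpow_natCast, Equiv.Perm.inv_eq_iff_eq] at hj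
          exact hj.symm
    obtain ⟨j, n₁, n₂, hj, hflow⟩ := hpow
    rcases hD.merge_or_split he with he | he
    · have h := hD.flow_pow_fst he j w n₁
      rw [hflow] at h
      obtain ⟨k, c, hc, rfl⟩ := hD.exists_mergeCycle he hj h.symm
      obtain ⟨f, hr⟩ := hc.exists_return
      obtain ⟨w', hw'⟩ := hr.contracting.exists_fixed
      obtain rfl := hr.eq_of_zpow_apply_eq hΨ hw' hm hgm
      exact ⟨k, c, hc.1, by simpa using (hr.orbit hΨ hw' n).2.symm⟩
    · have h := hD.flow_inv_pow_fst he j w n₂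
      rw [inv_pow, ← hflow, ← Equiv.Perm.mul_apply, inv_mul_cancel, Equiv.Perm.one_apply] at h
      obtain ⟨k, c, hc, rfl⟩ := hD.exists_splitCycle he hj h.symm
      obtain ⟨f, hr⟩ := hc.exists_return
      obtain ⟨w', hw'⟩ := hr.contracting.exists_fixed
      obtain rfl := hr.eq_of_zpow_apply_eq hΨ hw' hm hgm
      exact ⟨k, c, hc.1, by simpa using (hr.orbit hΨ hw' n).2.symm⟩
  · rintro (⟨e, he, rfl⟩ | ⟨k, c, hc, rfl⟩)
    · exact ⟨_, he.orbit hΨ (fun _ => false) 0⟩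
    · rcases hD.mergeCycle_or_splitCycle hc with hc | hc
      · obtain ⟨x, -, hx⟩ := hc.exists_attractor hΨ
        exact ⟨x, hx⟩
      · obtain ⟨x, -, hx⟩ := hc.exists_repellor hΨ
        exact ⟨x, hx⟩

theorem Reduces.exists_isModel {D D' : CylinderDiagram} (h : Reduces D D')
    (hD : ∃ Ψ : D.FlowSpace → Cantor, D.IsModel g Ψ) :
    ∃ Ψ : D'.FlowSpace → Cantor, D'.IsModel g Ψ := by
  induction h with
  | refl => exact hD
  | tail _ h ih =>
    obtain ⟨Ψ, hΨ⟩ := ih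
    exact hΨ.exists_of_ruleI h

end CylinderDiagram

theorem mainTheorem1 (g : ThompsonV) (P : StrandDiagram) (hP : P.Represents g) :
    -- Rule I cannot be applied infinitely often, and it can be applied as long as a
    -- merge-split pair is left
    Acc (fun D₂ D₁ => CylinderDiagram.RuleI D₁ D₂) P.onCylinder ∧
    (∀ D, CylinderDiagram.Reduces P.onCylinder D → ¬ D.IsReduced →
      ∃ D', CylinderDiagram.RuleI D D') ∧
    ∀ D, CylinderDiagram.Reduces P.onCylinder D → D.IsReduced →
      (D.IsUnionOfCircles →
        IsOfFinOrder g ∧ orderOf g = Finset.univ.lcm D.label) ∧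
      (¬ D.IsUnionOfCircles →
        ¬ IsOfFinOrder g ∧
        (∃ (k : ℕ) (c : Fin (k + 1) → D.Edge), D.IsMergeCycle c) ∧
        (∃ (k : ℕ) (c : Fin (k + 1) → D.Edge), D.IsSplitCycle c) ∧
        (∀ (k : ℕ) (c : Fin (k + 1) → D.Edge), D.IsMergeCycle c →
          ∃ x, IsAttractor g x ∧ (orbitOf g x).Finite ∧
            (orbitOf g x).ncard = D.labelSum c) ∧
        (∀ (k : ℕ) (c : Fin (k + 1) → D.Edge), D.IsSplitCycle c →
          ∃ x, IsRepellor g x ∧ (orbitOf g x).Finite ∧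
            (orbitOf g x).ncard = D.labelSum c) ∧
        finiteOrbitLengths g = D.cycleSums) := by
  refine ⟨CylinderDiagram.acc_ruleI _, fun D _ hD => CylinderDiagram.exists_ruleI hD,
    fun D hPD hD => ?_⟩
  obtain ⟨Ψ, hΨ⟩ := hPD.exists_isModel hP.exists_isModel
  refine ⟨fun h => ?_, fun h => ?_⟩
  · rw [← Submonoid.isOfFinOrder_coe, ← Subgroup.orderOf_coe]
    exact h.orderOf_eq hΨ
  · obtain ⟨⟨s⟩, ⟨m⟩⟩ := CylinderDiagram.nonempty_of_not_isUnionOfCircles h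
    obtain ⟨k, c, hc⟩ := hD.exists_isMergeCycle m
    refine ⟨?_, ⟨k, c, hc⟩, hD.exists_isSplitCycle s, fun _ _ hc => hc.exists_attractor hΨ,
      fun _ _ hc => hc.exists_repellor hΨ, hD.finiteOrbitLengths_eq hΨ⟩
    rw [← Submonoid.isOfFinOrder_coe]
    exact hc.not_isOfFinOrder hΨ
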